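/- Let $p$ be a prime and $F$ an algebraically closed field of characteristic $p$. All groups are finite and all modules are finitely generated left modules. For a group $G$ and an indecomposable $FG$-module $M$, a vertex of $M$ is a subgroup $P\le G$ that is minimal subject to $M$ being isomorphic to a direct summand of $\mathrm{Ind}_P^G(L)$ for some $FP$-module $L$; a $P$-source of $M$ is then an indecomposable $FP$-module $S$ such that $M$ is isomorphic to a direct summand of $\mathrm{Ind}_P^G(S)$. Pairs $(G,M)$ and $(G',M')$, each consisting of a group and a module over its group algebra, are called equivalent if there are a group isomorphism $\varphi:G\to G'$ and an $F$-linear isomorphism $\psi:M\to M'$ with $\psi(gm)=\varphi(g)\psi(m)$ for all $g\in G$, $m\in M$. A vertex-source pair of $(G,M)$ is any pair equivalent to $(P,S)$ for some vertex $P$ of $M$ and some $P$-source $S$ of $M$. For a set $\mathcal G$ of groups and a $p$-group $Q$, let $\mathcal V_{\mathcal G}(Q)$ be the set of equivalence classes of pairs $(Q,L)$, with $L$ an indecomposable $FQ$-module, such that $(Q,L)$ is a vertex-source pair of $(G,M)$ for some $G\in\mathcal G$ and some simple $FG$-module $M$. We say that Feit's Conjecture holds for $\mathcal G$ if $\mathcal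 V_{\mathcal G}(Q)$ is finite for every $p$-group $Q$. **Theorem.** Let $H$ be an abelian group and let $\mathcal U$ be a set of groups. For $U\in\mathcal U$, a homomorphism $\alpha:U\to\mathrm{Aut}(H)$ and a simple $FH$-module $E$, let $G=H\rtimes_\alpha U$, let $T_G(E)$ be the inertial group of $E$ in $G$, that is, the group of all $g\in G$ such that the conjugate $FH$-module ${}^gE$ is isomorphic to $E$, and let $T_{U,\alpha}(E)=U\cap T_G(E)$. Suppose that Feit's Conjecture holds for the set $$\{T_{U,\alpha}(E)\mid U\in\mathcal U,\ \alpha:U\to\mathrm{Aut}(H),\ E \text{ a simple } FH\text{-module}\}.$$ Then Feit's Conjecture holds for the set $$\{H\rtimes_\alpha U\mid U\in\mathcal U,\ \alpha:U\to\mathrm{Aut}(H)\}.$$ -/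

import Mathlib

universe u v

namespace FeitSource

section Modules

variable {F : Type*} [Field F] {G H : Type*} [Group G] [Group H]
  {V W : Type*} [AddCommGroup V] [Module F V] [AddCommGroup W] [Module F W]

/-- The module `V` is isomorphic to a direct summand of the module `W`:
there is a split monomorphism of `FG`-modules from `V` to `W`. -/
def IsDirectSummand (ρ : Representation F G V) (σ : Representation F G W) : Prop :=
  ∃ (i : ρ.IntertwiningMap σ) (r : σ.IntertwiningMap ρ), ∀ x : V, r (i x) = x

/-- A module is indecomposable if it is non-zero and is not the direct sum of two non-zero
submodules. -/
def IsIndecomposable (ρ : Representation F G V) : Prop :=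
  Nontrivial V ∧ ∀ A B : Subrepresentation ρ, IsCompl A B → A = ⊥ ∨ B = ⊥

/-- `V` is relatively `Q`-projective: it is isomorphic to a direct summand of the module
induced from some finitely generated `FQ`-module. -/
def IsRelativelyProjective {F : Type v} [Field F] {G : Type*} [Group G]
    {V : Type*} [AddCommGroup V] [Module F V]
    (Q : Subgroup G) (ρ : Representation F G V) : Prop :=
  ∃ L : FDRep F Q, IsDirectSummand ρ (Representation.ind Q.subtype L.ρ)

/-- `Q` is a vertex of the module `V`: it is minimal, with respect to inclusion, among the
subgroups relative to which `V` is projective. -/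
def IsVertex {F : Type v} [Field F] {G : Type*} [Group G]
    {V : Type*} [AddCommGroup V] [Module F V]
    (Q : Subgroup G) (ρ : Representation F G V) : Prop :=
  Minimal (fun R : Subgroup G => IsRelativelyProjective R ρ) Q

/-- For a vertex `Q` of the `FG`-module `V`, the `FQ`-module `W` is a `Q`-source of `V`: it is
indecomposable and `V` is isomorphic to a direct summand of the module induced from `W`. -/
def IsSource (Q : Subgroup G) (ρ : Representation F G V) (σ : Representation F Q W) : Prop :=
  IsIndecomposable σ ∧ IsDirectSummand ρ (Representation.ind Q.subtype σ)

/-- Equivalence of the pairs `(G, V)` and `(H, W)`. -/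
def PairEquiv (ρ : Representation F G V) (σ : Representation F H W) : Prop :=
  ∃ (φ : G ≃* H) (ψ : V ≃ₗ[F] W), ∀ (g : G) (x : V), ψ (ρ g x) = σ (φ g) (ψ x)

/-- `(Q, W)` is a vertex-source pair of `(G, V)`: it is equivalent to a pair `(P, S)` where
`P ≤ G` is a vertex of `V` and `S` is a `P`-source of `V`. -/
def IsVertexSourcePair {F : Type v} [Field F] {G Q : Type*} [Group G] [Group Q]
    {V W : Type*} [AddCommGroup V] [Module F V] [AddCommGroup W] [Module F W]
    (σ : Representation F Q W) (ρ : Representation F G V) : Prop :=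
  ∃ P : Subgroup G, IsVertex P ρ ∧ ∃ S : FDRep F P, IsSource P ρ S.ρ ∧ PairEquiv σ S.ρ

end Modules

/-- The equivalence of pairs `(Q, L)` for a fixed group `Q`, where `L` is a finitely generated
`FQ`-module. -/
def pairSetoid (F : Type v) [Field F] (Q : Type u) [Group Q] : Setoid (FDRep F Q) where
  r L M := PairEquiv L.ρ M.ρ
  iseqv :=
    { refl := fun _ => ⟨MulEquiv.refl _, LinearEquiv.refl _ _, fun _ _ => rfl⟩
      symm := by
        rintro L M ⟨φ, ψ, h⟩
        refine ⟨φ.symm, ψ.symm, fun g x => ?_⟩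
        rw [LinearEquiv.symm_apply_eq, h]
        simp
      trans := by
        rintro L M N ⟨φ, ψ, h⟩ ⟨φ', ψ', h'⟩
        exact ⟨φ.trans φ', ψ.trans ψ', fun g x => by simp [h, h']⟩ }

/-- `𝒱_𝒢(Q)`: the set of equivalence classes of pairs `(Q, L)`, with `L` an indecomposable
`FQ`-module, that are vertex-source pairs of `(G, M)` for some group `G` in `𝒢` and some simple
`FG`-module `M`. -/
def vertexSourceClasses (F : Type v) [Field F] (𝒢 : Set FiniteGrp.{u}) (Q : Type u) [Group Q] :
    Set (Quotient (pairSetoid F Q)) :=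
  {c | ∃ L : FDRep F Q, Quotient.mk (pairSetoid F Q) L = c ∧ IsIndecomposable L.ρ ∧
    ∃ G ∈ 𝒢, ∃ M : FDRep F G, Representation.IsIrreducible M.ρ ∧ IsVertexSourcePair L.ρ M.ρ}

/-- Feit's Conjecture holds for the set `𝒢` of finite groups: for every finite `p`-group `Q`, the
set `𝒱_𝒢(Q)` is finite. -/
def FeitConjectureHolds (p : ℕ) (F : Type v) [Field F] (𝒢 : Set FiniteGrp.{u}) : Prop :=
  ∀ Q : FiniteGrp.{u}, IsPGroup p Q → (vertexSourceClasses F 𝒢 Q).Finite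

/-- The inertial group in `G` of a module `E` for a normal subgroup `N` of `G`: all `g` in `G`
such that the conjugate module, on which `n` acts as `g⁻¹ n g` does on `E`, is isomorphic
to `E`. -/
def inertialGroup {F : Type*} [Field F] {G : Type*} [Group G] (N : Subgroup G) [N.Normal]
    {E : Type*} [AddCommGroup E] [Module F E] (ρ : Representation F N E) : Subgroup G where
  carrier := {g | ∃ ψ : E ≃ₗ[F] E, ∀ (n : N) (x : E),
    ψ (ρ (MulAut.conjNormal g⁻¹ n) x) = ρ n (ψ x)}
  one_mem' := ⟨LinearEquiv.refl _ _, by simp⟩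
  mul_mem' := by
    rintro a b ⟨ψ, hψ⟩ ⟨χ, hχ⟩
    refine ⟨χ.trans ψ, fun n x => ?_⟩
    simp only [LinearEquiv.trans_apply, mul_inv_rev, map_mul, MulAut.mul_apply]
    rw [hχ, hψ]
  inv_mem' := by
    rintro a ⟨ψ, hψ⟩
    refine ⟨ψ.symm, fun n x => ?_⟩
    rw [LinearEquiv.symm_apply_eq]
    have := hψ (MulAut.conjNormal a n) (ψ.symm x)
    rw [← MulAut.mul_apply, ← map_mul] at this
    simpa using this.symm

section Semidirect

variable {F : Type*} [Field F] {H U : Type*} [Group H] [Group U] (α : U →* MulAut H)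

instance finite_semidirectProduct [Finite H] [Finite U] : Finite (H ⋊[α] U) :=
  Finite.of_equiv (H × U) SemidirectProduct.equivProd.symm

instance normal_range_inl : (SemidirectProduct.inl : H →* H ⋊[α] U).range.Normal := by
  rw [SemidirectProduct.range_inl_eq_ker_rightHom]
  infer_instance

/-- `T_G(E)` for `G = H ⋊_α U` and an `FH`-module `E`, where `H` is identified with its image
in `G`. -/
noncomputable def semidirectInertialGroup {E : Type*} [AddCommGroup E] [Module F E]
    (ρ : Representation F H E) : Subgroup (H ⋊[α] U) :=
  inertialGroup (SemidirectProduct.inl : H →* H ⋊[α] U).range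
    (ρ.comp (MonoidHom.ofInjective
      (SemidirectProduct.inl_injective (φ := α))).symm.toMonoidHom)

/-- `T_{U,α}(E) = U ∩ T_G(E)`, as a subgroup of `U`. -/
noncomputable def complementInertialGroup {E : Type*} [AddCommGroup E] [Module F E]
    (ρ : Representation F H E) : Subgroup U :=
  (semidirectInertialGroup α ρ).comap SemidirectProduct.inr

end Semidirect

/-- `H ⋊ 𝒰`: the set of all semidirect products `H ⋊_α U`, for `U` in `𝒰` and
`α : U → Aut(H)`. -/
def semidirectProducts (H : Type u) [Group H] [Finite H] (𝒰 : Set FiniteGrp.{u}) :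
    Set FiniteGrp.{u} :=
  {G | ∃ U ∈ 𝒰, ∃ α : U →* MulAut H, G = FiniteGrp.of (H ⋊[α] U)}

/-- `𝒯(H ⋊ 𝒰)`: the set of all `T_{U,α}(E)`, for `U` in `𝒰`, `α : U → Aut(H)` and simple
`FH`-modules `E`. -/
def inertialSubgroups (F : Type v) [Field F] (H : Type u) [Group H] (𝒰 : Set FiniteGrp.{u}) :
    Set FiniteGrp.{u} :=
  {T | ∃ U ∈ 𝒰, ∃ α : U →* MulAut H, ∃ E : FDRep F H, Representation.IsIrreducible E.ρ ∧
    T = FiniteGrp.of (complementInertialGroup α E.ρ)}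

end FeitSource

/-! Let `M` be a simple module for `G = H ⋊ U`, with vertex `P` and source `L`. By Clifford theory
`M` is the direct sum of its weight spaces `M_χ`, for linear characters `χ` of `H`, and a non-zero
`M_χ` is a simple module for the stabilizer `T` of `χ` in `U`. This `T` is the inertial group of the
one-dimensional `FH`-module given by `χ`. The point is that, for a suitable `χ` fixed by `P`, the
image `R` of `P` in `U` is a vertex of `M_χ`, and `L` is a source of `M_χ` once it is viewed as an
`FR`-module. Hence every pair `(Q, L)` is inflated from a pair over a quotient `Q ⧸ N` that the
hypothesis already counts. Since `Q` has finitely many normal subgroups and each quotient finitely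
many automorphisms, finiteness follows.

The arguments run through relative traces of endomorphisms. Higman's criterion
(`isRelativelyProjective_iff`) turns relative projectivity into a trace being `1`. For a simple
module Schur's lemma makes traces scalar, so a non-zero trace is enough. A Mackey decomposition then
forces a vertex into a point stabilizer (`exists_vertex_le_stabilizer`). This one principle yields
the weight `χ` (`IsWeightProjection.exists_relTrace_ne_zero`), the minimality of `R`
(`IsCharStabilizer.isRelativelyProjective_imp_le`) and the surjectivity of the map from `M` to `L`
(`surjective_of_relTrace_comp_eq_one`).

Surjectivity is what lets `L` descend to `R`: the `p`-group `P ∩ H` lies in the kernel of every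
linear character in characteristic `p`, so it acts trivially on `M`, and therefore on the quotient
`L` of `M`. -/

namespace FeitSource

/-! ### Relative traces and the Mackey decomposition -/

section RelativeTrace

variable {F : Type*} [Field F] {G : Type*} [Group G] {A : Type*} [AddCommGroup A] [Module F A]

/-- The sum of the translates of `a` over the left cosets of `R`. -/
noncomputable def relTrace (τ : Representation F G A) (R : Subgroup G) (a : A) : A :=
  ∑ᶠ t : G ⧸ R, τ t.out a

variable {τ : Representation F G A}

theorem apply_out_of_fixed {R : Subgroup G} {a : A} (ha : ∀ r ∈ R, τ r a = a) (g : G) :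
    τ (g : G ⧸ R).out a = τ g a := by
  obtain ⟨r, hr⟩ := QuotientGroup.mk_out_eq_mul R g
  rw [hr, map_mul, Module.End.mul_apply, ha _ r.2]

theorem apply_out_smul {R : Subgroup G} {a : A} (ha : ∀ r ∈ R, τ r a = a) (g : G) (t : G ⧸ R) :
    τ (g • t).out a = τ g (τ t.out a) := by
  induction t using QuotientGroup.induction_on with
  | H s =>
    rw [← MulAction.Quotient.coe_smul_out, apply_out_of_fixed ha, smul_eq_mul, map_mul]
    rfl

theorem apply_relTrace [Finite G] {R : Subgroup G} {a : A} (ha : ∀ r ∈ R, τ r a = a) (g : G) :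
    τ g (relTrace τ R a) = relTrace τ R a := by
  have := Fintype.ofFinite (G ⧸ R)
  rw [relTrace, finsum_eq_sum_of_fintype, map_sum]
  simp_rw [← apply_out_smul ha]
  exact Equiv.sum_comp (MulAction.toPerm g) fun t : G ⧸ R => τ t.out a

theorem relTrace_stabilizer [Finite G] {X : Type*} [MulAction G X] {φ : X → A}
    (hφ : ∀ (g : G) (x : X), φ (g • x) = τ g (φ x)) (x : X) :
    relTrace τ (MulAction.stabilizer G x) (φ x) = ∑ᶠ y : MulAction.orbit G x, φ y := by
  rw [← finsum_comp_equiv (MulAction.orbitEquivQuotientStabilizer G x).symm, relTrace]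
  refine finsum_congr fun t => ?_
  rw [← hφ]
  conv_rhs => rw [← Quotient.out_eq' t]
  rfl

/-- Mackey's formula in the form used throughout. The sum over `(G ⧸ P) × Y` splits into `G`-orbits,
each orbit contains a point `(P, y)`, and the sum over that orbit is the trace from the stabilizer
`P ⊓ stabilizer y`. If all these traces vanished, so would the sum. -/
theorem exists_relTrace_ne_zero [Finite G] (P : Subgroup G) {Y : Type*} [Finite Y] [MulAction G Y]
    {φ : G ⧸ P → Y → A} (hφ : ∀ (g : G) (t : G ⧸ P) (y : Y), φ (g • t) (g • y) = τ g (φ t y))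
    (h : ∑ᶠ x : (G ⧸ P) × Y, φ x.1 x.2 ≠ 0) :
    ∃ y, relTrace τ (P ⊓ MulAction.stabilizer G y) (φ (1 : G) y) ≠ 0 := by
  classical
  by_contra! hy
  apply h
  have := Fintype.ofFinite ((G ⧸ P) × Y)
  rw [finsum_eq_sum_of_fintype, ← Finset.sum_fiberwise _
    (fun x => (Quotient.mk (MulAction.orbitRel G _) x))]
  refine Finset.sum_eq_zero fun ω _ => ?_
  induction ω using Quotient.inductionOn with
  | h x =>
  obtain ⟨t, y⟩ := x
  induction t using QuotientGroup.induction_on with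
  | H g =>
  -- Translating by `g⁻¹` moves `(gP, y)` to a point of its orbit over the trivial coset.
  have h1 := hy (g⁻¹ • y)
  have h2 : P ⊓ MulAction.stabilizer G (g⁻¹ • y) =
      MulAction.stabilizer G (((1 : G) : G ⧸ P), g⁻¹ • y) := by
    ext s
    simp only [Subgroup.mem_inf, MulAction.mem_stabilizer_iff, Prod.smul_mk, Prod.mk.injEq]
    refine and_congr_left fun _ => ?_
    rw [MulAction.Quotient.smul_coe, QuotientGroup.eq, smul_eq_mul, mul_one, mul_one, inv_mem_iff]
  rw [h2, relTrace_stabilizer (φ := fun x : (G ⧸ P) × Y => φ x.1 x.2) fun g x => hφ g x.1 x.2,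
    finsum_eq_sum_of_fintype] at h1
  rw [← h1]
  symm
  refine Finset.sum_bij (fun z _ => z.1) (fun z _ => ?_) (fun _ _ _ _ => Subtype.ext)
    (fun z hz => ?_) (fun _ _ => rfl)
  · obtain ⟨z, s, rfl⟩ := z
    simp only [Finset.mem_filter, Finset.mem_univ, true_and]
    refine Quotient.sound ⟨s * g⁻¹, ?_⟩
    simp [mul_smul]
  · simp only [Finset.mem_filter, Finset.mem_univ, true_and] at hz
    obtain ⟨s, rfl⟩ := Quotient.exact hz
    refine ⟨⟨_, s * g, ?_⟩, Finset.mem_univ _, rfl⟩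
    simp [mul_smul]

end RelativeTrace

end FeitSource

namespace FeitSource

open Representation

/-! ### Induced modules and Higman's criterion -/

section Induced

variable {F : Type*} [Field F] {G : Type*} [Group G]
  {V W X : Type*} [AddCommGroup V] [Module F V] [AddCommGroup W] [Module F W]
  [AddCommGroup X] [Module F X]
  {ρ : Representation F G V} {P : Subgroup G} {σ : Representation F P W}

theorem linHom_fixed_iff {f : Module.End F V} {g : G} :
    linHom ρ ρ g f = f ↔ ∀ v, f (ρ g v) = ρ g (f v) := by
  constructor
  · intro h v
    conv_lhs => rw [← h]
    simp
  · intro h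
    ext v
    simp [← h]

theorem relTrace_linHom_apply [Finite G] {τ : Representation F G W} (f : V →ₗ[F] W) (v : V)
    [Fintype (G ⧸ P)] :
    relTrace (linHom ρ τ) P f v = ∑ t : G ⧸ P, τ t.out (f (ρ t.out⁻¹ v)) := by
  rw [relTrace, finsum_eq_sum_of_fintype, LinearMap.sum_apply]
  rfl

theorem indV_mk_mul (p : P) (h : G) (w : W) :
    IndV.mk P.subtype σ (p * h) (σ p w) = IndV.mk P.subtype σ h w := by
  have := Coinvariants.mk_self_apply (Representation.tprod ((leftRegular F G).comp P.subtype) σ) p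
    (TensorProduct.tmul F (MonoidAlgebra.single h 1) w)
  simpa using this

/-- The linear map on an induced module given by a compatible family of linear maps. -/
noncomputable def indLift (f : G → W →ₗ[F] X)
    (hf : ∀ (p : P) (h : G) (w : W), f (p * h) (σ p w) = f h w) : IndV P.subtype σ →ₗ[F] X :=
  Coinvariants.lift _
    (TensorProduct.lift <| (Finsupp.lift _ _ _ f) ∘ₗ
      (MonoidAlgebra.coeffLinearEquiv F).toLinearMap)
    fun p ↦ by
      ext h w
      simp only [LinearMap.coe_comp, Function.comp_apply, MonoidAlgebra.lsingle_apply]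
      simp [hf]

theorem indLift_mk (f : G → W →ₗ[F] X)
    (hf : ∀ (p : P) (h : G) (w : W), f (p * h) (σ p w) = f h w) (h : G) (w : W) :
    indLift f hf (IndV.mk P.subtype σ h w) = f h w := by
  simp [indLift]

open Classical in
/-- The projection of an induced module onto the summand of the trivial coset. -/
noncomputable def indProj (σ : Representation F P W) : IndV P.subtype σ →ₗ[F] W :=
  indLift (fun h => if hh : h ∈ P then σ (⟨h, hh⟩ : P)⁻¹ else 0) fun p h w => by
    by_cases hh : h ∈ P
    · have h1 : (p : G) * h ∈ P := P.mul_mem p.2 hh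
      have h2 : (⟨p * h, h1⟩ : P) = p * ⟨h, hh⟩ := rfl
      simp only [h1, hh, dif_pos]
      rw [h2, mul_inv_rev, map_mul, Module.End.mul_apply, ← Module.End.mul_apply, ← map_mul]
      simp
    · have h1 : (p : G) * h ∉ P := fun h1 => hh ((P.mul_mem_cancel_left p.2).1 h1)
      simp [h1, hh]

theorem indProj_mk_of_mem {h : G} (hh : h ∈ P) (w : W) :
    indProj σ (IndV.mk P.subtype σ h w) = σ (⟨h, hh⟩ : P)⁻¹ w := by
  rw [indProj, indLift_mk, dif_pos hh]

theorem indProj_mk_of_notMem {h : G} (hh : h ∉ P) (w : W) :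
    indProj σ (IndV.mk P.subtype σ h w) = 0 := by
  rw [indProj, indLift_mk, dif_neg hh, LinearMap.zero_apply]

theorem indProj_ind (p : P) (x : IndV P.subtype σ) :
    indProj σ (ind P.subtype σ p x) = σ p (indProj σ x) := by
  suffices h : indProj σ ∘ₗ ind P.subtype σ p = σ p ∘ₗ indProj σ from LinearMap.congr_fun h x
  refine IndV.hom_ext _ _ fun h => LinearMap.ext fun w => ?_
  simp only [LinearMap.comp_apply]
  change indProj σ (ind P.subtype σ p (IndV.mk P.subtype σ h w)) =
    σ p (indProj σ (IndV.mk P.subtype σ h w))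
  rw [ind_mk]
  by_cases hh : h ∈ P
  · have h1 : h * (p : G)⁻¹ ∈ P := P.mul_mem hh (P.inv_mem p.2)
    have h2 : (⟨h * (p : G)⁻¹, h1⟩ : P) = ⟨h, hh⟩ * p⁻¹ := rfl
    rw [indProj_mk_of_mem h1, indProj_mk_of_mem hh, h2, mul_inv_rev, inv_inv, map_mul,
      Module.End.mul_apply]
  · have h1 : h * (p : G)⁻¹ ∉ P := fun h1 => hh ((P.mul_mem_cancel_right (P.inv_mem p.2)).1 h1)
    rw [indProj_mk_of_notMem h1, indProj_mk_of_notMem hh, map_zero]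

theorem ind_indMk_one (p : P) (w : W) :
    ind P.subtype σ p (IndV.mk P.subtype σ 1 w) = IndV.mk P.subtype σ 1 (σ p w) := by
  rw [ind_mk, one_mul, ← indV_mk_mul p, mul_inv_cancel]

theorem relTrace_indProj [Finite G] :
    relTrace (linHom (ind P.subtype σ) (ind P.subtype σ)) P (IndV.mk P.subtype σ 1 ∘ₗ indProj σ) =
      LinearMap.id := by
  classical
  have := Fintype.ofFinite (G ⧸ P)
  refine IndV.hom_ext _ _ fun h => LinearMap.ext fun w => ?_
  change relTrace (linHom (ind P.subtype σ) (ind P.subtype σ)) P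
    (IndV.mk P.subtype σ 1 ∘ₗ indProj σ) (IndV.mk P.subtype σ h w) = IndV.mk P.subtype σ h w
  rw [relTrace_linHom_apply, Finset.sum_eq_single ((h⁻¹ : G) : G ⧸ P)]
  · obtain ⟨p, hp⟩ := QuotientGroup.mk_out_eq_mul P h⁻¹
    rw [hp, ind_mk, LinearMap.comp_apply]
    have h1 : h * (h⁻¹ * (p : G))⁻¹⁻¹ = p := by group
    rw [h1, indProj_mk_of_mem p.2, ind_mk, one_mul, mul_inv_rev, inv_inv]
    exact indV_mk_mul p⁻¹ h w
  · intro t _ ht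
    rw [ind_mk, LinearMap.comp_apply, indProj_mk_of_notMem, map_zero, map_zero]
    intro hP
    apply ht
    rw [← QuotientGroup.out_eq' t, eq_comm, QuotientGroup.eq]
    simpa using hP
  · simp

/-- Higman's criterion with a prescribed module `σ`. Frobenius reciprocity on both sides turns a
split embedding into `FP`-maps `a` and `b`. The identity of the induced module is the trace of the
projection to the trivial coset, so "split" becomes trace `1`. -/
theorem isDirectSummand_ind_iff [Finite G] :
    IsDirectSummand ρ (ind P.subtype σ) ↔ ∃ (a : V →ₗ[F] W) (b : W →ₗ[F] V),
      (∀ (p : P) v, a (ρ p v) = σ p (a v)) ∧ (∀ (p : P) w, b (σ p w) = ρ p (b w)) ∧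
      relTrace (linHom ρ ρ) P (b ∘ₗ a) = 1 := by
  have := Fintype.ofFinite (G ⧸ P)
  constructor
  · rintro ⟨i, r, hri⟩
    refine ⟨indProj σ ∘ₗ i.toLinearMap, r.toLinearMap ∘ₗ IndV.mk P.subtype σ 1, fun p v => ?_,
      fun p w => ?_, LinearMap.ext fun v => ?_⟩
    · simp only [LinearMap.comp_apply, IntertwiningMap.toLinearMap_apply, i.isIntertwining]
      exact indProj_ind p (i v)
    · rw [LinearMap.comp_apply, ← ind_indMk_one, IntertwiningMap.toLinearMap_apply,
        r.isIntertwining]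
      rfl
    · have h := congrArg r (LinearMap.congr_fun (relTrace_indProj (P := P) (σ := σ)) (i v))
      rw [LinearMap.id_apply, hri, relTrace_linHom_apply, map_sum] at h
      rw [relTrace_linHom_apply, Module.End.one_apply]
      refine Eq.trans (Finset.sum_congr rfl fun t _ => ?_) h
      rw [r.isIntertwining, ← i.isIntertwining]
      rfl
  · rintro ⟨a, b, ha, hb, h⟩
    have hfix : ∀ p ∈ P, linHom ρ (ind P.subtype σ) p (IndV.mk P.subtype σ 1 ∘ₗ a) =
        IndV.mk P.subtype σ 1 ∘ₗ a := by
      intro p hp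
      lift p to P using hp
      ext v
      rw [linHom_apply, LinearMap.comp_apply, LinearMap.comp_apply, LinearMap.comp_apply,
        ind_indMk_one, ← ha, ρ.self_inv_apply]
      rfl
    -- `IndV.mk P.subtype σ h w` plays the role of `h⁻¹ ⊗ w`, whence the inverse on `h`.
    have hr : ∀ (p : P) (h : G) (w : W), (ρ (p * h)⁻¹ ∘ₗ b) (σ p w) = (ρ h⁻¹ ∘ₗ b) w := by
      intro p h w
      rw [LinearMap.comp_apply, hb, mul_inv_rev, map_mul, Module.End.mul_apply, ρ.inv_self_apply]
      rfl
    refine ⟨⟨relTrace (linHom ρ (ind P.subtype σ)) P (IndV.mk P.subtype σ 1 ∘ₗ a), fun g => ?_⟩,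
      ⟨indLift (σ := σ) (fun h => ρ h⁻¹ ∘ₗ b) hr, fun g => ?_⟩, fun v => ?_⟩
    · conv_lhs => rw [← apply_relTrace hfix g]
      ext v
      simp
    · refine IndV.hom_ext _ _ fun h => LinearMap.ext fun w => ?_
      change indLift _ hr (ind P.subtype σ g (IndV.mk P.subtype σ h w)) =
        ρ g (indLift _ hr (IndV.mk P.subtype σ h w))
      rw [ind_mk, indLift_mk, indLift_mk]
      simp
    · have h := LinearMap.congr_fun h v
      rw [relTrace_linHom_apply] at h
      change indLift _ hr (relTrace (linHom ρ (ind P.subtype σ)) P _ v) = v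
      rw [relTrace_linHom_apply, map_sum]
      refine Eq.trans (Finset.sum_congr rfl fun t _ => ?_) h
      rw [LinearMap.comp_apply, ind_mk, indLift_mk, one_mul, inv_inv]
      rfl

theorem isRelativelyProjective_iff {F : Type v} [Field F] {G : Type*} [Group G] [Finite G]
    {V : Type v} [AddCommGroup V] [Module F V] [Module.Finite F V] {ρ : Representation F G V}
    {P : Subgroup G} :
    IsRelativelyProjective P ρ ↔ ∃ f : Module.End F V, (∀ p ∈ P, linHom ρ ρ p f = f) ∧
      relTrace (linHom ρ ρ) P f = 1 := by
  constructor
  · rintro ⟨L, hL⟩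
    obtain ⟨a, b, ha, hb, h⟩ := isDirectSummand_ind_iff.1 hL
    refine ⟨_, fun p hp => linHom_fixed_iff.2 fun v => ?_, h⟩
    lift p to P using hp
    rw [LinearMap.comp_apply, ha, hb, LinearMap.comp_apply]
  · rintro ⟨f, hf, h⟩
    -- The restriction of `V` itself serves as the module to induce, with `a` the identity.
    refine ⟨FDRep.of (ρ.comp P.subtype), isDirectSummand_ind_iff.2 ⟨LinearMap.id, f, ?_, ?_, ?_⟩⟩
    · exact fun p v => rfl
    · exact fun p v => linHom_fixed_iff.1 (hf p p.2) v
    · simpa using h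

end Induced

end FeitSource

namespace FeitSource

open Representation

/-! ### Vertices and sources of simple modules -/

section Simple

variable {F : Type v} [Field F] {G : Type*} [Group G]
  {V : Type v} [AddCommGroup V] [Module F V] {ρ : Representation F G V}

theorem subrepresentation_eq_top (hρ : IsIrreducible ρ) (X : Submodule F V)
    (hX : ∀ g, ∀ x ∈ X, ρ g x ∈ X) (h0 : X ≠ ⊥) : X = ⊤ := by
  have := hρ.eq_bot_or_eq_top (⟨X, hX⟩ : Subrepresentation ρ)
  rcases this with h | h
  · exact absurd (congrArg Subrepresentation.toSubmodule h) h0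
  · exact congrArg Subrepresentation.toSubmodule h

theorem nontrivial_of_isIrreducible (hρ : IsIrreducible ρ) : Nontrivial V := by
  by_contra h
  rw [not_nontrivial_iff_subsingleton] at h
  obtain ⟨X, Y, hXY⟩ := hρ.toNontrivial
  exact hXY (Subrepresentation.toSubmodule_injective (Subsingleton.elim _ _))

theorem linHom_mul (g : G) (e f : Module.End F V) :
    linHom ρ ρ g (e * f) = linHom ρ ρ g e * linHom ρ ρ g f := by
  ext v
  simp

theorem relTrace_smul [Finite G] {A : Type*} [AddCommGroup A] [Module F A] (τ : Representation F G A)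
    (P : Subgroup G) (c : F) (a : A) : relTrace τ P (c • a) = c • relTrace τ P a := by
  have := Fintype.ofFinite (G ⧸ P)
  simp only [relTrace, finsum_eq_sum_of_fintype, map_smul, Finset.smul_sum]

/-- Fitting's lemma: for large `n` the module is the direct sum of the kernel and the range of `d ^
n`, and indecomposability kills one of them. -/
theorem bijective_or_pow_eq_zero {W : Type*} [AddCommGroup W] [Module F W]
    [Module.Finite F W] {σ : Representation F G W} (hσ : IsIndecomposable σ) {d : Module.End F W}
    (hd : ∀ g w, d (σ g w) = σ g (d w)) : Function.Bijective d ∨ ∃ n, d ^ n = 0 := by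
  obtain ⟨n, h1, hn⟩ := ((d.eventually_isCompl_ker_pow_range_pow).and
    (Filter.eventually_ge_atTop 1)).exists
  have hdn : ∀ g w, (d ^ n) (σ g w) = σ g ((d ^ n) w) := by
    clear h1 hn
    intro g w
    induction n with
    | zero => rfl
    | succ n ih => rw [pow_succ', Module.End.mul_apply, Module.End.mul_apply, ih, hd]
  let A : Subrepresentation σ := ⟨LinearMap.ker (d ^ n), fun g w hw => by
    rw [LinearMap.mem_ker] at hw ⊢
    rw [hdn, hw, map_zero]⟩
  let B : Subrepresentation σ := ⟨LinearMap.range (d ^ n), by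
    rintro g _ ⟨w, rfl⟩
    exact ⟨σ g w, hdn g w⟩⟩
  have hAB : IsCompl A B := by
    rw [isCompl_iff, disjoint_iff, codisjoint_iff] at h1 ⊢
    exact ⟨Subrepresentation.toSubmodule_injective h1.1,
      Subrepresentation.toSubmodule_injective h1.2⟩
  rcases hσ.2 A B hAB with h | h
  · left
    have hk : LinearMap.ker (d ^ n) = ⊥ := congrArg Subrepresentation.toSubmodule h
    have hi : Function.Injective d := by
      rw [← LinearMap.ker_eq_bot, eq_bot_iff, ← hk]
      intro w hw
      rw [LinearMap.mem_ker] at hw ⊢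
      rw [← Nat.sub_add_cancel hn, pow_succ, Module.End.mul_apply, hw, map_zero]
    exact ⟨hi, LinearMap.injective_iff_surjective.1 hi⟩
  · right
    have hk : LinearMap.range (d ^ n) = ⊥ := congrArg Subrepresentation.toSubmodule h
    exact ⟨n, LinearMap.range_eq_bot.1 hk⟩

/-- The stabilizer of `gP` is `gPg⁻¹`; a finite group contained in a conjugate of itself equals that
conjugate, so `g` normalizes `P`. -/
theorem mul_mul_inv_mem_of_le_stabilizer {G : Type*} [Group G] [Finite G] {P : Subgroup G} {g : G}
    (h : P ≤ MulAction.stabilizer G (g : G ⧸ P)) {p : G} (hp : p ∈ P) : g * p * g⁻¹ ∈ P := by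
  have h1 : ∀ q : P, g⁻¹ * q * g ∈ P := fun q => by
    have h2 := MulAction.mem_stabilizer_iff.1 (h (P.inv_mem q.2))
    rw [MulAction.Quotient.smul_coe, QuotientGroup.eq, smul_eq_mul] at h2
    simpa using h2
  have h3 : Function.Injective fun q : P => (⟨_, h1 q⟩ : P) := fun q q' hq => by
    simpa using hq
  obtain ⟨q, hq⟩ := Finite.surjective_of_injective h3 ⟨p, hp⟩
  have h4 : g⁻¹ * q * g = p := congrArg Subtype.val hq
  rw [← h4]
  simp [mul_assoc]

theorem finsum_prod_mul {ι κ R : Type*} [Finite ι] [Finite κ] [Ring R] (f : ι → R) (g : κ → R) :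
    ∑ᶠ x : ι × κ, f x.1 * g x.2 = (∑ᶠ i, f i) * ∑ᶠ j, g j := by
  have := Fintype.ofFinite ι
  have := Fintype.ofFinite κ
  simp only [finsum_eq_sum_of_fintype, Finset.sum_mul_sum, Fintype.sum_prod_type]

variable [Module.Finite F V]

theorem exists_eq_smul_one [IsAlgClosed F] (hρ : IsIrreducible ρ) {f : Module.End F V}
    (hf : ∀ g, linHom ρ ρ g f = f) : ∃ c : F, f = c • 1 := by
  have := nontrivial_of_isIrreducible hρ
  obtain ⟨c, hc⟩ := Module.End.exists_eigenvalue f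
  refine ⟨c, ?_⟩
  have h := subrepresentation_eq_top hρ (f.eigenspace c) (fun g x hx => ?_) hc
  · ext v
    have hv : v ∈ f.eigenspace c := h ▸ Submodule.mem_top
    rw [Module.End.mem_eigenspace_iff.1 hv]
    rfl
  · rw [Module.End.mem_eigenspace_iff] at hx ⊢
    rw [linHom_fixed_iff.1 (hf g), hx, map_smul]

variable [IsAlgClosed F] [Finite G]

theorem exists_relTrace_eq_smul_one (hρ : IsIrreducible ρ) {P : Subgroup G} {f : Module.End F V}
    (hf : ∀ p ∈ P, linHom ρ ρ p f = f) : ∃ c : F, relTrace (linHom ρ ρ) P f = c • 1 :=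
  exists_eq_smul_one hρ (apply_relTrace hf)

theorem exists_relTrace_eq_one (hρ : IsIrreducible ρ) {P : Subgroup G}
    {f : Module.End F V} (hf : ∀ p ∈ P, linHom ρ ρ p f = f) (h : relTrace (linHom ρ ρ) P f ≠ 0) :
    ∃ c : F, relTrace (linHom ρ ρ) P (c • f) = 1 := by
  obtain ⟨c, hc⟩ := exists_relTrace_eq_smul_one hρ hf
  refine ⟨c⁻¹, ?_⟩
  rw [relTrace_smul, hc, inv_smul_smul₀]
  rintro rfl
  exact h (by rw [hc, zero_smul])

theorem isRelativelyProjective_of_relTrace_ne_zero (hρ : IsIrreducible ρ) {P : Subgroup G}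
    {f : Module.End F V} (hf : ∀ p ∈ P, linHom ρ ρ p f = f) (h : relTrace (linHom ρ ρ) P f ≠ 0) :
    IsRelativelyProjective P ρ := by
  obtain ⟨c, hc⟩ := exists_relTrace_eq_one hρ hf h
  exact isRelativelyProjective_iff.2 ⟨c • f, fun p hp => by rw [map_smul, hf p hp], hc⟩

/-- The Mackey decomposition gives a non-zero trace from `P ⊓ stabilizer y`. The simple module is
then projective relative to this subgroup, which minimality of the vertex forces to be all of `P`.
-/
theorem exists_vertex_le_stabilizer (hρ : IsIrreducible ρ) {P : Subgroup G} (hP : IsVertex P ρ)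
    {Y : Type*} [Finite Y] [MulAction G Y] {φ : G ⧸ P → Y → Module.End F V}
    (hφ : ∀ (g : G) (t : G ⧸ P) (y : Y), φ (g • t) (g • y) = linHom ρ ρ g (φ t y))
    (h : ∑ᶠ x : (G ⧸ P) × Y, φ x.1 x.2 ≠ 0) :
    ∃ y, P ≤ MulAction.stabilizer G y ∧ relTrace (linHom ρ ρ) P (φ (1 : G) y) ≠ 0 := by
  obtain ⟨y, hy⟩ := exists_relTrace_ne_zero P hφ h
  have h1 : IsRelativelyProjective (P ⊓ MulAction.stabilizer G y) ρ := by
    refine isRelativelyProjective_of_relTrace_ne_zero hρ (f := φ (1 : G) y) (fun p hp => ?_) hy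
    rw [← hφ, (MulAction.mem_stabilizer_iff.1 hp.2 : p • y = y)]
    congr 1
    rw [MulAction.Quotient.smul_coe, QuotientGroup.eq, smul_eq_mul, mul_one, mul_one, inv_mem_iff]
    exact hp.1
  have h2 : P ≤ P ⊓ MulAction.stabilizer G y := hP.2 h1 inf_le_left
  refine ⟨y, h2.trans inf_le_right, ?_⟩
  rwa [le_antisymm inf_le_left h2] at hy

/-- A source of a simple module is an epimorphic image of the restriction of the module. -/
theorem surjective_of_relTrace_comp_eq_one (hρ : IsIrreducible ρ) {P : Subgroup G}
    (hP : IsVertex P ρ) {W : Type*} [AddCommGroup W] [Module F W] [Module.Finite F W]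
    {σ : Representation F P W} (hσ : IsIndecomposable σ) {a : V →ₗ[F] W} {b : W →ₗ[F] V}
    (ha : ∀ (p : P) v, a (ρ p v) = σ p (a v)) (hb : ∀ (p : P) w, b (σ p w) = ρ p (b w))
    (h : relTrace (linHom ρ ρ) P (b ∘ₗ a) = 1) : Function.Surjective a := by
  have hV := nontrivial_of_isIrreducible hρ
  let A : Submodule F (Module.End F V) :=
    { carrier := {f | ∀ p ∈ P, linHom ρ ρ p f = f}
      add_mem' := fun hx hy p hp => by rw [map_add, hx p hp, hy p hp]
      zero_mem' := fun p _ => map_zero _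
      smul_mem' := fun c x hx p hp => by rw [map_smul, hx p hp] }
  have hA1 : (1 : Module.End F V) ∈ A := fun p _ => linHom_fixed_iff.2 fun _ => rfl
  have hAmul : ∀ x ∈ A, ∀ y ∈ A, x * y ∈ A := fun x hx y hy p hp => by
    rw [linHom_mul, hx p hp, hy p hp]
  have hba : b ∘ₗ a ∈ A := fun p hp => linHom_fixed_iff.2 fun v => by
    lift p to P using hp
    rw [LinearMap.comp_apply, ha, hb, LinearMap.comp_apply]
  let I : Module.End F V → Submodule F (Module.End F V) := fun x => A.map (LinearMap.mulLeft F x)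
  -- Among the `P`-endomorphisms of non-zero trace, `x` generates a minimal right ideal `x A`.
  -- Minimality will allow `x` to be recovered from a multiple of itself by a conjugate of `b ∘ₗ a`.
  obtain ⟨x, ⟨hxA, hx⟩, hmin⟩ := (InvImage.wf I wellFounded_lt).has_min
    {x | x ∈ A ∧ relTrace (linHom ρ ρ) P x ≠ 0} ⟨b ∘ₗ a, hba, by rw [h]; exact one_ne_zero⟩
  obtain ⟨t, ht, hxt⟩ := exists_vertex_le_stabilizer hρ hP (Y := G ⧸ P)
    (φ := fun s t => linHom ρ ρ s.out x * linHom ρ ρ t.out (b ∘ₗ a))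
    (fun g s t => by rw [apply_out_smul hxA, apply_out_smul hba, linHom_mul])
    (by
      rw [finsum_prod_mul (fun s : G ⧸ P => linHom ρ ρ s.out x)
        (fun t : G ⧸ P => linHom ρ ρ t.out (b ∘ₗ a))]
      change relTrace (linHom ρ ρ) P x * relTrace (linHom ρ ρ) P (b ∘ₗ a) ≠ 0
      rwa [h, mul_one])
  induction t using QuotientGroup.induction_on with
  | H t =>
  rw [apply_out_of_fixed hxA, apply_out_of_fixed hba, map_one, Module.End.one_apply] at hxt
  set y := linHom ρ ρ t (b ∘ₗ a) with hy
  have hyA : y ∈ A := fun p hp => by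
    have h1 : (p * t : G) = ((t : G) : G ⧸ P) := MulAction.mem_stabilizer_iff.1 (ht hp)
    rw [hy, ← Module.End.mul_apply, ← map_mul, ← apply_out_of_fixed hba, h1,
      apply_out_of_fixed hba]
  have hle : I (x * y) ≤ I x := by
    rintro _ ⟨w, hw, rfl⟩
    exact ⟨y * w, hAmul y hyA w hw, by simp⟩
  have heq : I (x * y) = I x := by
    by_contra hne
    exact hmin (x * y) ⟨hAmul x hxA y hyA, hxt⟩ (lt_of_le_of_ne hle hne)
  obtain ⟨w, hwA, hw⟩ : x ∈ I (x * y) := heq ▸ ⟨1, hA1, by simp⟩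
  have hw' : ∀ v, x (ρ t (b (a (ρ t⁻¹ (w v))))) = x v := fun v => LinearMap.congr_fun hw v
  -- Since `x = x * y * w`, the map `x ∘ ρ t ∘ b` is unchanged by precomposition with `d`. If `d` is
  -- nilpotent, that map is zero and so is `x`; if `d` is bijective, its leftmost factor `a` is
  -- surjective.
  let d : Module.End F W := a ∘ₗ ρ t⁻¹ ∘ₗ w ∘ₗ ρ t ∘ₗ b
  have hd : ∀ (p : P) l, d (σ p l) = σ p (d l) := fun p l => by
    have h1 : ∀ v, ρ t (ρ p v) = ρ (t * p * t⁻¹) (ρ t v) := fun v => by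
      simp [← Module.End.mul_apply, ← map_mul]
    have h2 : ∀ v, ρ t⁻¹ (ρ (t * p * t⁻¹) v) = ρ p (ρ t⁻¹ v) := fun v => by
      simp [← Module.End.mul_apply, ← map_mul, mul_assoc]
    have h3 := linHom_fixed_iff.1 (hwA _ (mul_mul_inv_mem_of_le_stabilizer ht p.2))
    simp only [d, LinearMap.comp_apply]
    rw [hb, h1, h3, h2, ha]
  rcases bijective_or_pow_eq_zero hσ hd with hd | ⟨n, hn⟩
  · intro l
    obtain ⟨l', rfl⟩ := hd.2 l
    exact ⟨_, rfl⟩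
  · exfalso
    have h1 : ∀ m l, x (ρ t (b ((d ^ m) l))) = x (ρ t (b l)) := by
      intro m
      induction m with
      | zero => exact fun l => rfl
      | succ m ih =>
        intro l
        rw [pow_succ, Module.End.mul_apply, ih]
        exact hw' _
    apply hx
    have h2 : x = 0 := by
      ext v
      rw [← hw' v, ← h1 n, hn]
      simp
    rw [h2, relTrace]
    simp

end Simple

end FeitSource

namespace FeitSource

open Representation

/-! ### Weight spaces of the abelian normal subgroup -/

section Weights

variable {F : Type v} [Field F] {G H : Type*} [Group G] [CommGroup H] (ι : H →* G)
  {V : Type v} [AddCommGroup V] [Module F V] (ρ : Representation F G V)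

/-- The subspace on which `H` acts through the linear character `χ`. -/
def weightSpace (χ : H →* Fˣ) : Submodule F V where
  carrier := {v | ∀ h, ρ (ι h) v = (χ h : F) • v}
  add_mem' hx hy h := by rw [map_add, hx h, hy h, smul_add]
  zero_mem' h := by rw [map_zero, smul_zero]
  smul_mem' c x hx h := by rw [map_smul, hx h, smul_comm]

/-- The action on linear characters of `H` induced by an action on `H`. -/
@[reducible] def weightAction (F : Type*) [Field F] (κ : G →* MulAut H) :
    MulAction G (H →* Fˣ) where
  smul g χ := χ.comp (κ g⁻¹).toMonoidHom
  one_smul χ := by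
    ext h
    change (χ (κ (1 : G)⁻¹ h) : F) = χ h
    simp
  mul_smul g g' χ := by
    ext h
    change (χ (κ (g * g')⁻¹ h) : F) = χ (κ g'⁻¹ (κ g⁻¹ h))
    simp

variable {ι ρ}

theorem apply_mem_weightSpace {κ : G →* MulAut H} (hκ : ∀ g h, ι (κ g h) = g * ι h * g⁻¹)
    {χ : H →* Fˣ} {v : V} (hv : v ∈ weightSpace ι ρ χ) (g : G) :
    ρ g v ∈ weightSpace ι ρ ((weightAction F κ).smul g χ) := by
  intro h
  have h1 : ι h * g = g * ι (κ g⁻¹ h) := by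
    rw [hκ]
    group
  rw [← Module.End.mul_apply, ← map_mul, h1, map_mul, Module.End.mul_apply, hv, map_smul]
  rfl

/-- On a minimal non-zero `H`-invariant subspace the commuting operators of `H` are scalars, and
these scalars form a linear character. -/
theorem exists_weightSpace_ne_bot [IsAlgClosed F] [Module.Finite F V] [Nontrivial V] :
    ∃ χ : H →* Fˣ, weightSpace ι ρ χ ≠ ⊥ := by
  obtain ⟨X, ⟨hX, hX0⟩, hmin⟩ := (wellFounded_lt (α := Submodule F V)).has_min
    {X | (∀ h, ∀ x ∈ X, ρ (ι h) x ∈ X) ∧ X ≠ ⊥} ⟨⊤, by simp, top_ne_bot⟩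
  have hsc : ∀ h, ∃ c : F, ∀ x ∈ X, ρ (ι h) x = c • x := by
    intro h
    have : Nontrivial X := (Submodule.nontrivial_iff_ne_bot).2 hX0
    obtain ⟨c, hc⟩ := Module.End.exists_eigenvalue ((ρ (ι h)).restrict (hX h))
    obtain ⟨x, hx, hx0⟩ := hc.exists_hasEigenvector
    rw [Module.End.mem_eigenspace_iff] at hx
    have hx' : ρ (ι h) x = c • (x : V) := congrArg Subtype.val hx
    refine ⟨c, fun y hy => ?_⟩
    -- The eigenspace in `X` is `H`-invariant because `H` is commutative, so it is all of `X` by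
    -- minimality.
    have hle : X ⊓ (Module.End.eigenspace (ρ (ι h)) c) = X := by
      by_contra hne
      refine hmin (X ⊓ (Module.End.eigenspace (ρ (ι h)) c)) ⟨fun h' y hy => ⟨hX h' y hy.1, ?_⟩, ?_⟩
        (lt_of_le_of_ne inf_le_left hne)
      · have := Module.End.mem_eigenspace_iff.1 hy.2
        rw [SetLike.mem_coe, Module.End.mem_eigenspace_iff, ← Module.End.mul_apply, ← map_mul,
          ← map_mul, mul_comm, map_mul, map_mul, Module.End.mul_apply, this, map_smul]
      · intro h0
        have h1 : (x : V) ∈ X ⊓ (Module.End.eigenspace (ρ (ι h)) c) :=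
          ⟨x.2, Module.End.mem_eigenspace_iff.2 hx'⟩
        rw [h0, Submodule.mem_bot] at h1
        exact hx0 (Subtype.ext h1)
    rw [← hle] at hy
    exact Module.End.mem_eigenspace_iff.1 hy.2
  choose c hc using hsc
  obtain ⟨v, hv, hv0⟩ := Submodule.exists_mem_ne_zero_of_ne_bot hX0
  let χ : H →* F :=
    { toFun := c
      map_one' := by
        have := hc 1 v hv
        rw [map_one, map_one, Module.End.one_apply] at this
        exact smul_left_injective F hv0 (by simpa using this.symm)
      map_mul' := fun h h' => by
        refine smul_left_injective F hv0 ?_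
        change c (h * h') • v = (c h * c h') • v
        rw [← hc _ v hv, map_mul, map_mul, Module.End.mul_apply, hc h' v hv, map_smul, hc h v hv,
          smul_smul, mul_comm] }
  refine ⟨χ.toHomUnits, fun h0 => hv0 ?_⟩
  rw [← Submodule.mem_bot F, ← h0]
  exact fun h => hc h v hv

/-- Applying a linear functional to a vanishing sum of weight vectors gives a linear relation
between characters, which is trivial by Dedekind's theorem. -/
theorem iSupIndep_weightSpace : iSupIndep (weightSpace (V := V) ι ρ) := by
  rw [iSupIndep_iff_finsetSum_eq_zero_imp_eq_zero]
  intro s v hv hs χ hχ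
  have hind : LinearIndependent F fun χ : H →* Fˣ => fun h : H => (χ h : F) :=
    (linearIndependent_monoidHom H F).comp (fun χ : H →* Fˣ => (Units.coeHom F).comp χ)
      fun χ χ' h => MonoidHom.ext fun x => Units.ext (DFunLike.congr_fun h x)
  rw [← Module.forall_dual_apply_eq_zero_iff F]
  intro l
  refine linearIndependent_iff'.1 hind s (fun χ => l (v χ)) (funext fun h => ?_) χ hχ
  have h1 := congrArg (fun x => l (ρ (ι h) x)) hs
  simp only [map_zero, map_sum] at h1
  rw [Finset.sum_apply, Pi.zero_apply, ← h1]
  refine Finset.sum_congr rfl fun μ hμ => ?_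
  rw [hv μ hμ h, map_smul, Pi.smul_apply, smul_eq_mul, smul_eq_mul, mul_comm]

/-- `e` is the system of projections onto the weight spaces of `H`. -/
structure IsWeightProjection (ι : H →* G) (ρ : Representation F G V)
    (e : (H →* Fˣ) → Module.End F V) : Prop where
  apply_mem : ∀ χ v, e χ v ∈ weightSpace ι ρ χ
  apply_self : ∀ χ, ∀ v ∈ weightSpace ι ρ χ, e χ v = v
  apply_ne : ∀ χ μ, μ ≠ χ → ∀ v ∈ weightSpace ι ρ μ, e χ v = 0
  sum_eq : ∑ᶠ χ, e χ = 1

/-- `G` permutes the weight spaces, so their sum is a non-zero submodule and equals `V` by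
simplicity. No assumption on the order of `H` is needed. -/
theorem exists_isWeightProjection [IsAlgClosed F] [Module.Finite F V] [Finite H]
    (hρ : IsIrreducible ρ) {κ : G →* MulAut H} (hκ : ∀ g h, ι (κ g h) = g * ι h * g⁻¹) :
    ∃ e, IsWeightProjection ι ρ e := by
  classical
  have := nontrivial_of_isIrreducible hρ
  have := Fintype.ofFinite (H →* Fˣ)
  have htop : ⨆ χ, weightSpace ι ρ χ = ⊤ := by
    refine subrepresentation_eq_top hρ _ (fun g x hx => ?_) ?_
    · refine Submodule.iSup_induction _ (motive := fun x => ρ g x ∈ ⨆ χ, weightSpace ι ρ χ) hx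
        (fun χ v hv => ?_) ?_ ?_
      · exact Submodule.mem_iSup_of_mem _ (apply_mem_weightSpace hκ hv g)
      · rw [map_zero]
        exact zero_mem _
      · intro y z hy hz
        rw [map_add]
        exact add_mem hy hz
    · obtain ⟨χ, hχ⟩ := exists_weightSpace_ne_bot (ι := ι) (ρ := ρ)
      exact fun h0 => hχ (eq_bot_iff.2 (h0 ▸ le_iSup _ χ))
  have hint : DirectSum.IsInternal (weightSpace (V := V) ι ρ) :=
    (DirectSum.isInternal_submodule_iff_iSupIndep_and_iSup_eq_top _).2
      ⟨iSupIndep_weightSpace, htop⟩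
  let _ := hint.chooseDecomposition
  let e : (H →* Fˣ) → Module.End F V := fun χ =>
    (weightSpace ι ρ χ).subtype ∘ₗ DirectSum.component F _ _ χ ∘ₗ
      (DirectSum.decomposeLinearEquiv (weightSpace (V := V) ι ρ)).toLinearMap
  have h1 : ∀ χ, ∀ v ∈ weightSpace ι ρ χ, e χ v = v := fun χ v hv =>
    DirectSum.decompose_of_mem_same _ hv
  have h2 : ∀ χ μ, μ ≠ χ → ∀ v ∈ weightSpace ι ρ μ, e χ v = 0 := fun χ μ hμ v hv =>
    DirectSum.decompose_of_mem_ne _ hv hμ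
  refine ⟨e, fun χ v => Subtype.property _, h1, h2, ?_⟩
  rw [finsum_eq_sum_of_fintype]
  ext v
  rw [LinearMap.sum_apply, Module.End.one_apply]
  have hv : v ∈ ⨆ χ, weightSpace ι ρ χ := htop ▸ Submodule.mem_top
  refine Submodule.iSup_induction _ (motive := fun v => ∑ χ, e χ v = v) hv (fun χ v hv => ?_) ?_ ?_
  · rw [Finset.sum_eq_single χ (fun μ _ hμ => h2 μ χ hμ.symm v hv) (by simp), h1 χ v hv]
  · simp
  · intro x y hx hy
    simp only [map_add, Finset.sum_add_distrib, hx, hy]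

namespace IsWeightProjection

variable {e : (H →* Fˣ) → Module.End F V} (he : IsWeightProjection ι ρ e)

include he

theorem mul_self (χ : H →* Fˣ) : e χ * e χ = e χ := by
  ext v
  exact he.apply_self χ _ (he.apply_mem χ v)

theorem ext_of_eqOn [Finite H] {f f' : Module.End F V}
    (h : ∀ χ, ∀ v ∈ weightSpace ι ρ χ, f v = f' v) : f = f' := by
  have := Fintype.ofFinite (H →* Fˣ)
  have h1 := he.sum_eq
  rw [finsum_eq_sum_of_fintype] at h1
  rw [← mul_one f, ← mul_one f', ← h1, Finset.mul_sum, Finset.mul_sum]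
  refine Finset.sum_congr rfl fun χ _ => ?_
  ext v
  exact h χ _ (he.apply_mem χ v)

theorem smul_eq [Finite H] {κ : G →* MulAut H} (hκ : ∀ g h, ι (κ g h) = g * ι h * g⁻¹) (g : G)
    (χ : H →* Fˣ) : e ((weightAction F κ).smul g χ) = linHom ρ ρ g (e χ) := by
  let _ := weightAction F κ
  refine he.ext_of_eqOn fun μ v hv => ?_
  change e (g • χ) v = ρ g (e χ (ρ g⁻¹ v))
  have h1 : ρ g⁻¹ v ∈ weightSpace ι ρ (g⁻¹ • μ) := apply_mem_weightSpace hκ hv g⁻¹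
  by_cases h : μ = g • χ
  · subst h
    rw [inv_smul_smul] at h1
    rw [he.apply_self _ _ hv, he.apply_self _ _ h1, ρ.self_inv_apply]
  · rw [he.apply_ne _ _ h _ hv, he.apply_ne _ _ (fun h2 => h (inv_smul_eq_iff.1 h2)) _ h1, map_zero]

/-- A vertex of a simple module fixes a weight of the module, and the corresponding block of a map
of non-zero trace also has non-zero trace. -/
theorem exists_relTrace_ne_zero [IsAlgClosed F] [Module.Finite F V] [Finite H] [Finite G]
    (hρ : IsIrreducible ρ) {κ : G →* MulAut H} (hκ : ∀ g h, ι (κ g h) = g * ι h * g⁻¹)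
    {P : Subgroup G} (hP : IsVertex P ρ) {f : Module.End F V}
    (hf : ∀ p ∈ P, linHom ρ ρ p f = f) (hf1 : relTrace (linHom ρ ρ) P f = 1) :
    ∃ χ : H →* Fˣ, (∀ p ∈ P, (weightAction F κ).smul p χ = χ) ∧
      relTrace (linHom ρ ρ) P (e χ * f * e χ) ≠ 0 := by
  let _ := weightAction F κ
  have := nontrivial_of_isIrreducible hρ
  have := Fintype.ofFinite (H →* Fˣ)
  have := Fintype.ofFinite (G ⧸ P)
  obtain ⟨χ, hχ, h⟩ := exists_vertex_le_stabilizer hρ hP (Y := H →* Fˣ)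
    (φ := fun t χ => e χ * linHom ρ ρ t.out f * e χ)
    (fun g t χ => by
      rw [apply_out_smul hf, linHom_mul, linHom_mul, ← he.smul_eq hκ g χ]
      rfl)
    -- The double sum is `∑ e χ * relTrace f * e χ = ∑ e χ = 1`.
    (by
      have h1 := he.sum_eq
      rw [relTrace, finsum_eq_sum_of_fintype] at hf1
      rw [finsum_eq_sum_of_fintype] at h1 ⊢
      rw [Fintype.sum_prod_type_right]
      simp only [← Finset.sum_mul, ← Finset.mul_sum]
      rw [hf1]
      simp only [mul_one, he.mul_self]
      rw [h1]
      exact one_ne_zero)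
  refine ⟨χ, fun p hp => MulAction.mem_stabilizer_iff.1 (hχ hp), ?_⟩
  rwa [apply_out_of_fixed hf, map_one, Module.End.one_apply] at h

end IsWeightProjection

/-- In characteristic `p` the only `p`-power root of unity is `1`, by the Frobenius identity. -/
theorem apply_eq_one_of_pow_eq_one {p : ℕ} [Fact p.Prime] [CharP F p] {Q : Type*} [Group Q]
    (χ : Q →* Fˣ) {h : Q} {n : ℕ} (hh : h ^ p ^ n = 1) : χ h = 1 := by
  have h1 : (χ h : F) ^ p ^ n = 1 := by
    rw [← Units.val_pow_eq_pow_val, ← map_pow, hh, map_one, Units.val_one]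
  have h2 : ((χ h : F) - 1) ^ p ^ n = 0 := by
    rw [sub_pow_char_pow, h1, one_pow, sub_self]
  exact Units.ext (sub_eq_zero.1
    ((pow_eq_zero_iff (pow_ne_zero _ (Fact.out : p.Prime).ne_zero)).1 h2))

theorem apply_eq_of_pow_eq_one {p : ℕ} [Fact p.Prime] [CharP F p] [Finite H]
    {e : (H →* Fˣ) → Module.End F V} (he : IsWeightProjection ι ρ e) {h : H} {n : ℕ}
    (hh : h ^ p ^ n = 1) (v : V) : ρ (ι h) v = v := by
  suffices h1 : ρ (ι h) = 1 by rw [h1, Module.End.one_apply]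
  refine he.ext_of_eqOn fun χ v hv => ?_
  rw [hv, apply_eq_one_of_pow_eq_one χ hh, Units.val_one, one_smul, Module.End.one_apply]

end Weights

end FeitSource

namespace FeitSource

open Representation SemidirectProduct

/-! ### Comparison of sums over cosets -/

section CosetSums

theorem apply_out_of_mul_right_invariant {G A : Type*} [Group G] {R : Subgroup G} {ψ : G → A}
    (hψ : ∀ g, ∀ r ∈ R, ψ (g * r) = ψ g) (g : G) : ψ (g : G ⧸ R).out = ψ g := by
  obtain ⟨r, hr⟩ := QuotientGroup.mk_out_eq_mul R g
  rw [hr, hψ _ _ r.2]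

variable {A : Type*} [AddCommGroup A] {G U : Type*} [Group G] [Group U]

/-- The fibres of `G ⧸ R → U ⧸ π(R)` are translates of one another, and `m` is their common size;
when `R` contains the kernel the map is bijective. -/
theorem exists_finsum_coset_map [Finite G] [Finite U] {π : G →* U} (hπ : Function.Surjective π)
    (R : Subgroup G) {ψ : U → A} (hψ : ∀ u, ∀ r ∈ R.map π, ψ (u * r) = ψ u) :
    ∃ m : ℕ, (π.ker ≤ R → m = 1) ∧
      ∑ᶠ x : G ⧸ R, ψ (π x.out) = m • ∑ᶠ y : U ⧸ R.map π, ψ y.out := by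
  classical
  have := Fintype.ofFinite (G ⧸ R)
  have := Fintype.ofFinite (U ⧸ R.map π)
  let q : G ⧸ R → U ⧸ R.map π := fun x => (π x.out : U)
  have hq : ∀ g : G, q g = (π g : U) := fun g => by
    obtain ⟨r, hr⟩ := QuotientGroup.mk_out_eq_mul R g
    simp only [q]
    rw [hr, eq_comm, QuotientGroup.eq, map_mul, inv_mul_cancel_left]
    exact ⟨r, r.2, rfl⟩
  have hqs : ∀ (g : G) x, q (g • x) = π g • q x := fun g x => by
    induction x using QuotientGroup.induction_on with
    | H s => rw [MulAction.Quotient.smul_coe, hq, hq, MulAction.Quotient.smul_coe, smul_eq_mul,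
        smul_eq_mul, map_mul]
  refine ⟨(Finset.univ.filter fun x => q x = ((1 : U) : U ⧸ R.map π)).card, fun hk => ?_, ?_⟩
  · rw [Finset.card_eq_one]
    refine ⟨((1 : G) : G ⧸ R), Finset.ext fun x => ?_⟩
    simp only [Finset.mem_filter, Finset.mem_univ, true_and, Finset.mem_singleton]
    constructor
    · induction x using QuotientGroup.induction_on with
      | H s =>
      rw [hq, eq_comm, QuotientGroup.eq, inv_one, one_mul, eq_comm, QuotientGroup.eq, inv_one,
        one_mul]
      rintro ⟨r, hr, hrs⟩
      have h1 : r⁻¹ * s ∈ π.ker := by rw [MonoidHom.mem_ker, map_mul, map_inv, hrs, inv_mul_cancel]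
      exact (R.mul_mem_cancel_left (R.inv_mem hr)).1 (hk h1)
    · rintro rfl
      rw [hq, map_one]
  · rw [finsum_eq_sum_of_fintype, finsum_eq_sum_of_fintype, ← Finset.sum_fiberwise _ q,
      Finset.smul_sum]
    refine Finset.sum_congr rfl fun y _ => ?_
    induction y using QuotientGroup.induction_on with
    | H u =>
    obtain ⟨g, rfl⟩ := hπ u
    have h1 : ∀ x ∈ Finset.univ.filter (fun x => q x = (π g : U)),
        ψ (π x.out) = ψ ((π g : U) : U ⧸ R.map π).out := fun x hx => by
      rw [← (Finset.mem_filter.1 hx).2]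
      exact (apply_out_of_mul_right_invariant hψ _).symm
    rw [Finset.sum_congr rfl h1, Finset.sum_const]
    congr 1
    refine Finset.card_bij (fun x _ => g⁻¹ • x) (fun x hx => ?_)
      (fun x _ x' _ h => MulAction.injective _ h) (fun x hx => ⟨g • x, ?_, inv_smul_smul g x⟩)
    · rw [Finset.mem_filter] at hx ⊢
      refine ⟨Finset.mem_univ _, ?_⟩
      rw [hqs, hx.2, MulAction.Quotient.smul_coe, smul_eq_mul, map_inv, inv_mul_cancel]
    · rw [Finset.mem_filter] at hx ⊢
      refine ⟨Finset.mem_univ _, ?_⟩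
      rw [hqs, hx.2, MulAction.Quotient.smul_coe, smul_eq_mul, mul_one]

theorem finsum_coset_subgroup [Finite U] {T Q : Subgroup U} {ψ : U → A}
    (hψ0 : ∀ u, u ∉ T → ψ u = 0) (hψ : ∀ u, ∀ r ∈ Q, ψ (u * r) = ψ u) :
    ∑ᶠ y : U ⧸ Q, ψ y.out = ∑ᶠ t : T ⧸ Q.subgroupOf T, ψ t.out := by
  have := Fintype.ofFinite (U ⧸ Q)
  have := Fintype.ofFinite (T ⧸ Q.subgroupOf T)
  rw [finsum_eq_sum_of_fintype, finsum_eq_sum_of_fintype]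
  refine (Fintype.sum_of_injective (fun t : T ⧸ Q.subgroupOf T => ((t.out : U) : U ⧸ Q))
    (fun t t' h => ?_) _ _ (fun y hy => ?_)
    fun t => (apply_out_of_mul_right_invariant hψ _).symm).symm
  · rw [QuotientGroup.eq] at h
    rw [← QuotientGroup.out_eq' t, ← QuotientGroup.out_eq' t', QuotientGroup.eq,
      Subgroup.mem_subgroupOf]
    exact h
  · refine hψ0 _ fun hT => hy ⟨((⟨y.out, hT⟩ : T) : T ⧸ Q.subgroupOf T), ?_⟩
    obtain ⟨r, hr⟩ := QuotientGroup.mk_out_eq_mul (Q.subgroupOf T) ⟨y.out, hT⟩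
    simp only
    rw [hr]
    conv_rhs => rw [← QuotientGroup.out_eq' y]
    rw [eq_comm, QuotientGroup.eq, Subgroup.coe_mul, inv_mul_cancel_left]
    exact Subgroup.mem_subgroupOf.1 r.2

end CosetSums

/-! ### Clifford theory in the semidirect product -/

section Semidirect

variable {F : Type v} [Field F] {H U : Type*} [CommGroup H] [Group U] {α : U →* MulAut H}
  {V : Type v} [AddCommGroup V] [Module F V] {ρ : Representation F (H ⋊[α] U) V}

theorem inl_comp_rightHom_apply (g : H ⋊[α] U) (h : H) :
    (inl (α.comp rightHom g h) : H ⋊[α] U) = g * inl h * g⁻¹ := by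
  ext
  · simp [mul_comm]
  · simp

/-- `T` is the stabilizer of the linear character `χ`. -/
def IsCharStabilizer (α : U →* MulAut H) (χ : H →* Fˣ) (T : Subgroup U) : Prop :=
  ∀ u, u ∈ T ↔ ∀ h, χ (α u⁻¹ h) = χ h

namespace IsCharStabilizer

variable {χ : H →* Fˣ} {T : Subgroup U} (hT : IsCharStabilizer α χ T)

include hT

theorem right_mem_iff (g : H ⋊[α] U) :
    g.right ∈ T ↔ (weightAction F (α.comp rightHom)).smul g χ = χ :=
  (hT g.right).trans ⟨fun h => MonoidHom.ext h, fun h => DFunLike.congr_fun h⟩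

theorem apply_inr_mem (u : T) {v : V} (hv : v ∈ weightSpace inl ρ χ) :
    ρ (inr (u : U)) v ∈ weightSpace inl ρ χ := by
  have h1 := apply_mem_weightSpace (ι := (inl : H →* H ⋊[α] U)) inl_comp_rightHom_apply hv
    (inr (u : U))
  rwa [(hT.right_mem_iff (inr (u : U))).1 u.2] at h1

/-- The action of the stabilizer of `χ` on the weight space of `χ`. -/
def weightRep (ρ : Representation F (H ⋊[α] U) V) :
    Representation F T (weightSpace (inl : H →* H ⋊[α] U) ρ χ) where
  toFun u := (ρ (inr (u : U))).restrict fun _ hv => hT.apply_inr_mem u hv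
  map_one' := by
    ext v
    simp
  map_mul' u u' := by
    ext v
    simp

theorem apply_eq (g : H ⋊[α] U) (hg : g.right ∈ T)
    (v : weightSpace (inl : H →* H ⋊[α] U) ρ χ) :
    ρ g v = (χ g.left : F) • (hT.weightRep ρ ⟨g.right, hg⟩ v : V) := by
  conv_lhs => rw [← inl_left_mul_inr_right g, map_mul, Module.End.mul_apply]
  exact hT.apply_inr_mem ⟨g.right, hg⟩ v.2 g.left

variable {e : (H →* Fˣ) → Module.End F V}

theorem apply_comm [Finite H] (he : IsWeightProjection (inl : H →* H ⋊[α] U) ρ e) {g : H ⋊[α] U}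
    (hg : g.right ∈ T) (v : V) : e χ (ρ g v) = ρ g (e χ v) := by
  refine linHom_fixed_iff.1 ?_ v
  rw [← he.smul_eq inl_comp_rightHom_apply, (hT.right_mem_iff g).1 hg]

/-- A non-zero submodule `X` of the weight space has translates spanning `V`. Translates by `g` with
`g.right ∈ T` stay in `X`, while the others lie in different weight spaces and are killed by `e χ`.
Hence `e χ` maps `V` into `X`. -/
theorem isIrreducible_weightRep [Finite H] [Module.Finite F V] (hρ : IsIrreducible ρ)
    (he : IsWeightProjection (inl : H →* H ⋊[α] U) ρ e)
    (hχ : e χ ≠ 0) : IsIrreducible (hT.weightRep ρ) := by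
  let _ := weightAction F (α.comp (rightHom : H ⋊[α] U →* U))
  have hnt : Nontrivial (Subrepresentation (hT.weightRep ρ)) := by
    refine ⟨⊥, ⊤, fun h => hχ ?_⟩
    ext v
    have h1 : (⟨e χ v, he.apply_mem χ v⟩ : weightSpace (inl : H →* H ⋊[α] U) ρ χ) ∈
        (⊥ : Subrepresentation (hT.weightRep ρ)) := h ▸ Submodule.mem_top
    exact congrArg Subtype.val ((Submodule.mem_bot F).1 h1)
  refine { eq_bot_or_eq_top := fun X => or_iff_not_imp_left.2 fun hX => ?_ }
  let Y : Submodule F V := X.toSubmodule.map (weightSpace (inl : H →* H ⋊[α] U) ρ χ).subtype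
  have hY : ⨆ g, Y.map (ρ g) = ⊤ := by
    refine subrepresentation_eq_top hρ _ (fun g x hx => ?_) fun h0 => hX ?_
    · refine Submodule.iSup_induction _ (motive := fun x => ρ g x ∈ ⨆ g, Y.map (ρ g)) hx
        (fun g' v hv => ?_) ?_ ?_
      · obtain ⟨y, hy, rfl⟩ := hv
        refine Submodule.mem_iSup_of_mem (g * g') ⟨y, hy, ?_⟩
        rw [map_mul, Module.End.mul_apply]
      · rw [map_zero]
        exact zero_mem _
      · intro y z hy hz
        rw [map_add]
        exact add_mem hy hz
    · refine Subrepresentation.toSubmodule_injective (eq_bot_iff.2 fun x hx => ?_)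
      have h1 : (x : V) ∈ ⨆ g, Y.map (ρ g) :=
        Submodule.mem_iSup_of_mem 1 ⟨x, ⟨x, hx, rfl⟩, by simp⟩
      rw [h0] at h1
      exact Subtype.ext h1
  have hmem : ∀ v, e χ v ∈ Y := by
    intro v
    have hv : v ∈ ⨆ g, Y.map (ρ g) := hY ▸ Submodule.mem_top
    refine Submodule.iSup_induction _ (motive := fun v => e χ v ∈ Y) hv ?_ ?_ ?_
    · rintro g _ ⟨_, ⟨y, hy, rfl⟩, rfl⟩
      by_cases hg : g.right ∈ T
      · rw [hT.apply_comm he hg, Submodule.subtype_apply, he.apply_self _ _ y.2, hT.apply_eq g hg]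
        exact Y.smul_mem _ ⟨_, X.apply_mem_toSubmodule _ hy, rfl⟩
      · rw [Submodule.subtype_apply, he.apply_ne χ _ (mt (hT.right_mem_iff g).2 hg) _
          (apply_mem_weightSpace inl_comp_rightHom_apply y.2 g)]
        exact zero_mem _
    · rw [map_zero]
      exact zero_mem _
    · intro x y hx hy
      rw [map_add]
      exact add_mem hx hy
  refine Subrepresentation.toSubmodule_injective (eq_top_iff.2 fun x _ => ?_)
  obtain ⟨y, hy, hyx⟩ := hmem x
  rw [he.apply_self _ _ x.2] at hyx
  rwa [← Subtype.ext hyx]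

end IsCharStabilizer

/-- The extension by zero of an endomorphism of a weight space. -/
def weightExtend {ι : H →* H ⋊[α] U} {e : (H →* Fˣ) → Module.End F V}
    (he : IsWeightProjection ι ρ e) {χ : H →* Fˣ} (f : Module.End F (weightSpace ι ρ χ)) :
    Module.End F V :=
  (weightSpace ι ρ χ).subtype ∘ₗ f ∘ₗ (e χ).codRestrict _ (he.apply_mem χ)

theorem weightExtend_apply {ι : H →* H ⋊[α] U} {e : (H →* Fˣ) → Module.End F V}
    (he : IsWeightProjection ι ρ e) {χ : H →* Fˣ} (f : Module.End F (weightSpace ι ρ χ)) (v : V) :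
    weightExtend he f v = f ⟨e χ v, he.apply_mem χ v⟩ := rfl

theorem weightExtend_apply_coe {ι : H →* H ⋊[α] U} {e : (H →* Fˣ) → Module.End F V}
    (he : IsWeightProjection ι ρ e) {χ : H →* Fˣ} (f : Module.End F (weightSpace ι ρ χ))
    (v : weightSpace ι ρ χ) : weightExtend he f v = f v := by
  rw [weightExtend_apply]
  congr 2
  exact Subtype.ext (he.apply_self _ _ v.2)

namespace IsCharStabilizer

variable {χ : H →* Fˣ} {T : Subgroup U} (hT : IsCharStabilizer α χ T)
  {e : (H →* Fˣ) → Module.End F V} (he : IsWeightProjection (inl : H →* H ⋊[α] U) ρ e)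
  (f : Module.End F (weightSpace (inl : H →* H ⋊[α] U) ρ χ))

include hT

/-- The scalars by which the `H`-parts of `g` and `g⁻¹` act on the weight space cancel under
conjugation. -/
theorem linHom_weightExtend_of_mem {g : H ⋊[α] U} (hg : g.right ∈ T)
    (v : weightSpace (inl : H →* H ⋊[α] U) ρ χ) :
    linHom ρ ρ g (weightExtend he f) v =
      linHom (hT.weightRep ρ) (hT.weightRep ρ) ⟨g.right, hg⟩ f v := by
  have hg' : g⁻¹.right ∈ T := T.inv_mem hg
  have h1 : ρ g⁻¹ (v : V) = ((χ g⁻¹.left : F) • hT.weightRep ρ ⟨g⁻¹.right, hg'⟩ v :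
      weightSpace (inl : H →* H ⋊[α] U) ρ χ) := hT.apply_eq g⁻¹ hg' v
  have h2 : χ g.left * χ g⁻¹.left = 1 := by
    rw [inv_left, (hT g.right).1 hg, map_inv, mul_inv_cancel]
  change ρ g (weightExtend he f (ρ g⁻¹ v)) = _
  rw [h1, weightExtend_apply_coe, hT.apply_eq g hg, map_smul, map_smul, Submodule.coe_smul,
    smul_smul, ← Units.val_mul, h2, Units.val_one, one_smul]
  rfl

theorem linHom_weightExtend_of_notMem {g : H ⋊[α] U} (hg : g.right ∉ T)
    (v : weightSpace (inl : H →* H ⋊[α] U) ρ χ) :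
    linHom ρ ρ g (weightExtend he f) v = 0 := by
  let _ := weightAction F (α.comp (rightHom : H ⋊[α] U →* U))
  have h1 := apply_mem_weightSpace inl_comp_rightHom_apply v.2 g⁻¹
  have h2 : e χ (ρ g⁻¹ v) = 0 := by
    refine he.apply_ne χ _ (fun h => hg ?_) _ h1
    have h3 := (hT.right_mem_iff g⁻¹).2 h
    simpa using h3
  have h3 : weightExtend he f (ρ g⁻¹ v) = 0 := by
    rw [weightExtend, LinearMap.comp_apply, LinearMap.comp_apply]
    have : (e χ).codRestrict _ (he.apply_mem χ) (ρ g⁻¹ v) = 0 := Subtype.ext h2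
    rw [this, map_zero, map_zero]
  change ρ g (weightExtend he f (ρ g⁻¹ v)) = 0
  rw [h3, map_zero]

variable {f}

theorem linHom_weightExtend_eq [Finite H] {g : H ⋊[α] U} (hg : g.right ∈ T)
    (hf : linHom (hT.weightRep ρ) (hT.weightRep ρ) ⟨g.right, hg⟩ f = f) :
    linHom ρ ρ g (weightExtend he f) = weightExtend he f := by
  ext v
  have hg' : g⁻¹.right ∈ T := T.inv_mem hg
  have h1 : linHom ρ ρ g (weightExtend he f) v = linHom ρ ρ g (weightExtend he f) (e χ v) := by
    change ρ g (weightExtend he f (ρ g⁻¹ v)) = ρ g (weightExtend he f (ρ g⁻¹ (e χ v)))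
    rw [← hT.apply_comm he hg']
    simp only [weightExtend_apply, he.apply_self _ _ (he.apply_mem _ _)]
  rw [h1, hT.linHom_weightExtend_of_mem he f hg ⟨_, he.apply_mem χ v⟩, hf]
  rfl

/-- Comparison of the relative traces in a semidirect product and in a character stabilizer. -/
theorem exists_relTrace_weightExtend [Finite H] [Finite U] {R : Subgroup (H ⋊[α] U)}
    (hR : R.map rightHom ≤ T)
    (hf : ∀ r ∈ (R.map rightHom).subgroupOf T,
      linHom (hT.weightRep ρ) (hT.weightRep ρ) r f = f)
    (v : weightSpace (inl : H →* H ⋊[α] U) ρ χ) :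
    ∃ m : ℕ, ((rightHom : H ⋊[α] U →* U).ker ≤ R → m = 1) ∧
      relTrace (linHom ρ ρ) R (weightExtend he f) v =
        m • (relTrace (linHom (hT.weightRep ρ) (hT.weightRep ρ))
          ((R.map rightHom).subgroupOf T) f v : V) := by
  classical
  have := Fintype.ofFinite ((H ⋊[α] U) ⧸ R)
  have := Fintype.ofFinite (T ⧸ (R.map rightHom).subgroupOf T)
  let ψ : U → V := fun u => if hu : u ∈ T then
    (linHom (hT.weightRep ρ) (hT.weightRep ρ) ⟨u, hu⟩ f v : V) else 0
  have hψT : ∀ t : T, ψ t = linHom (hT.weightRep ρ) (hT.weightRep ρ) t f v := fun t =>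
    dif_pos t.2
  have hψ0 : ∀ u, u ∉ T → ψ u = 0 := fun u hu => dif_neg hu
  have hψ : ∀ u, ∀ r ∈ R.map rightHom, ψ (u * r) = ψ u := by
    intro u r hr
    by_cases hu : u ∈ T
    · have h1 := hψT (⟨u, hu⟩ * ⟨r, hR hr⟩)
      rw [map_mul, Module.End.mul_apply, hf _ hr, ← hψT ⟨u, hu⟩] at h1
      exact h1
    · have h1 : u * r ∉ T := fun h => hu ((T.mul_mem_cancel_right (hR hr)).1 h)
      simp only [ψ, dif_neg hu, dif_neg h1]
  obtain ⟨m, hm, h⟩ := exists_finsum_coset_map rightHom_surjective R hψ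
  rw [finsum_coset_subgroup hψ0 hψ] at h
  refine ⟨m, hm, ?_⟩
  simp only [relTrace, finsum_eq_sum_of_fintype, hψT] at h ⊢
  rw [LinearMap.sum_apply, LinearMap.sum_apply, AddSubmonoidClass.coe_finsetSum, ← h]
  refine Finset.sum_congr rfl fun x _ => ?_
  by_cases hx : x.out.right ∈ T
  · rw [hT.linHom_weightExtend_of_mem he f hx]
    exact (hψT ⟨_, hx⟩).symm
  · rw [hT.linHom_weightExtend_of_notMem he f hx]
    exact (hψ0 _ hx).symm

end IsCharStabilizer

end Semidirect

end FeitSource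

namespace FeitSource

open Representation SemidirectProduct

/-! ### The image of the vertex in the stabilizer -/

section Vertex

variable {F : Type v} [Field F] {H U : Type*} [CommGroup H] [Group U] {α : U →* MulAut H}
  {V : Type v} [AddCommGroup V] [Module F V]
  {ρ : Representation F (H ⋊[α] U) V}
  {χ : H →* Fˣ} {T : Subgroup U} (hT : IsCharStabilizer α χ T)
  {e : (H →* Fˣ) → Module.End F V} (he : IsWeightProjection (inl : H →* H ⋊[α] U) ρ e)

/-- The restriction of an endomorphism to a weight space, followed by the projection. -/
def weightCompress (f : Module.End F V) : Module.End F (weightSpace (inl : H →* H ⋊[α] U) ρ χ) :=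
  (e χ).codRestrict _ (he.apply_mem χ) ∘ₗ f ∘ₗ (weightSpace (inl : H →* H ⋊[α] U) ρ χ).subtype

theorem weightExtend_weightCompress (f : Module.End F V) :
    weightExtend he (weightCompress (χ := χ) he f) = e χ * f * e χ := rfl

variable [IsAlgClosed F] [Finite H] [Finite U] [Module.Finite F V]

namespace IsCharStabilizer

include hT he

/-- Minimality of the image of `P`. The preimage `R` of `Q` contains `H`, so the comparison of
traces has multiplicity `1`, and an endomorphism of trace `1` from `Q` extends by zero to one of
non-zero trace from `R`. The vertex `P` then lies in a conjugate of `R`, and comparing orders in `U`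
leaves no room between `Q` and the image of `P`. -/
theorem isRelativelyProjective_imp_le (hρ : IsIrreducible ρ) {P : Subgroup (H ⋊[α] U)}
    (hP : IsVertex P ρ) {f : Module.End F V} (hf : ∀ p ∈ P, linHom ρ ρ p f = f)
    (hf0 : relTrace (linHom ρ ρ) P f ≠ 0) (hχ : e χ ≠ 0) {Q : Subgroup T}
    (hQ : IsRelativelyProjective Q (hT.weightRep ρ))
    (hQP : Q ≤ (P.map rightHom).subgroupOf T) : (P.map rightHom).subgroupOf T ≤ Q := by
  have := nontrivial_of_isIrreducible hρ
  have := Fintype.ofFinite (H →* Fˣ)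
  obtain ⟨f₁, hf₁, hf₁1⟩ := isRelativelyProjective_iff.1 hQ
  let R : Subgroup (H ⋊[α] U) := (Q.map T.subtype).comap rightHom
  have hRmap : R.map rightHom = Q.map T.subtype :=
    Subgroup.map_comap_eq_self_of_surjective rightHom_surjective _
  have hRQ : (R.map rightHom).subgroupOf T = Q := by
    rw [hRmap]
    exact Subgroup.comap_map_eq_self_of_injective T.subtype_injective Q
  have hRT : R.map rightHom ≤ T := hRmap ▸ Subgroup.map_subtype_le Q
  have hfix : ∀ r ∈ R, linHom ρ ρ r (weightExtend he f₁) = weightExtend he f₁ := by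
    rintro r ⟨t, ht, htr⟩
    have hr : r.right ∈ T := by
      have h1 : (t : U) = r.right := htr
      exact h1 ▸ t.2
    refine hT.linHom_weightExtend_eq he hr (hf₁ _ ?_)
    rwa [← (Subtype.ext htr : t = ⟨r.right, hr⟩)]
  have hne : relTrace (linHom ρ ρ) R (weightExtend he f₁) ≠ 0 := by
    intro h0
    apply hχ
    ext v
    obtain ⟨m, hm, h⟩ := hT.exists_relTrace_weightExtend he hRT (f := f₁)
      (fun r hr => hf₁ r (hRQ ▸ hr)) ⟨e χ v, he.apply_mem χ v⟩
    rw [hRQ, hf₁1, h0, hm, one_smul] at h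
    · exact h.symm
    · intro k hk
      rw [MonoidHom.mem_ker] at hk
      rw [Subgroup.mem_comap, hk]
      exact one_mem _
  obtain ⟨c, hc⟩ := exists_relTrace_eq_smul_one hρ hf
  obtain ⟨c', hc'⟩ := exists_relTrace_eq_smul_one hρ hfix
  obtain ⟨s, hs, -⟩ := exists_vertex_le_stabilizer hρ hP (Y := (H ⋊[α] U) ⧸ R)
    (φ := fun t s => linHom ρ ρ t.out f * linHom ρ ρ s.out (weightExtend he f₁))
    (fun g t s => by rw [apply_out_smul hf, apply_out_smul hfix, linHom_mul])
    (by
      rw [finsum_prod_mul (fun t : (H ⋊[α] U) ⧸ P => linHom ρ ρ t.out f)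
        (fun s : (H ⋊[α] U) ⧸ R => linHom ρ ρ s.out (weightExtend he f₁))]
      change relTrace (linHom ρ ρ) P f * relTrace (linHom ρ ρ) R (weightExtend he f₁) ≠ 0
      rw [hc] at hf0 ⊢
      rw [hc'] at hne ⊢
      rw [smul_mul_smul_comm, one_mul]
      exact smul_ne_zero (mul_ne_zero (fun h => hf0 (by rw [h, zero_smul]))
        (fun h => hne (by rw [h, zero_smul]))) one_ne_zero)
  induction s using QuotientGroup.induction_on with
  | H g =>
  have hconj : ∀ t : (P.map rightHom).subgroupOf T,
      ∃ t' : Q, (t' : U) = g.right⁻¹ * (t : U) * g.right := by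
    intro t
    obtain ⟨x, hx, hxt⟩ := Subgroup.mem_subgroupOf.1 t.2
    have h2 := MulAction.mem_stabilizer_iff.1 (hs (P.inv_mem hx))
    rw [MulAction.Quotient.smul_coe, QuotientGroup.eq, smul_eq_mul, mul_inv_rev, inv_inv] at h2
    obtain ⟨t', ht', h3⟩ := h2
    refine ⟨⟨t', ht'⟩, h3.trans ?_⟩
    rw [← hxt]
    simp
  choose c hc using hconj
  have hinj : Function.Injective c := by
    intro t t' h
    have h1 := hc t
    rw [h, hc t'] at h1
    exact Subtype.ext (Subtype.ext (by simpa using h1.symm))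
  exact (Subgroup.eq_of_le_of_card_ge hQP (Nat.card_le_card_of_injective c hinj)).ge

/-- The trace in `G` is a non-zero scalar and, on the weight space, a multiple of the trace in `T`.
The multiplicity is irrelevant in this direction. -/
theorem relTrace_weightCompress_ne_zero (hρ : IsIrreducible ρ) {P : Subgroup (H ⋊[α] U)}
    (hPT : P.map rightHom ≤ T) {f : Module.End F V}
    (hf : ∀ p ∈ P, linHom ρ ρ p (e χ * f * e χ) = e χ * f * e χ)
    (hf' : ∀ r ∈ (P.map rightHom).subgroupOf T, linHom (hT.weightRep ρ) (hT.weightRep ρ) r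
      (weightCompress he f) = weightCompress he f)
    (hf0 : relTrace (linHom ρ ρ) P (e χ * f * e χ) ≠ 0) (hχ : e χ ≠ 0) :
    relTrace (linHom (hT.weightRep ρ) (hT.weightRep ρ)) ((P.map rightHom).subgroupOf T)
      (weightCompress he f) ≠ 0 := by
  intro h0
  obtain ⟨c, hc⟩ := exists_relTrace_eq_smul_one hρ hf
  apply hχ
  ext v
  obtain ⟨m, -, h⟩ := hT.exists_relTrace_weightExtend he hPT hf' ⟨e χ v, he.apply_mem χ v⟩
  rw [weightExtend_weightCompress, h0, hc] at h
  have hc0 : c ≠ 0 := fun h1 => hf0 (by rw [hc, h1, zero_smul])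
  have h1 : c • e χ v = 0 := by simpa using h
  exact (smul_eq_zero.1 h1).resolve_left hc0

end IsCharStabilizer

end Vertex

/-! ### Descent of vertex-source pairs -/

section VertexSource

theorem isIndecomposable_of_surjective {F : Type*} [Field F] {G Q : Type*} [Group G] [Group Q]
    {W : Type*} [AddCommGroup W] [Module F W] {σ : Representation F G W}
    {τ : Representation F Q W} {π : G → Q} (h : ∀ g, τ (π g) = σ g)
    (hσ : IsIndecomposable σ) : IsIndecomposable τ := by
  refine ⟨hσ.1, fun A B hAB => ?_⟩
  let A' : Subrepresentation σ := ⟨A.toSubmodule, fun g v hv => h g ▸ A.apply_mem_toSubmodule _ hv⟩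
  let B' : Subrepresentation σ := ⟨B.toSubmodule, fun g v hv => h g ▸ B.apply_mem_toSubmodule _ hv⟩
  have hAB' : IsCompl A' B' := by
    rw [isCompl_iff, disjoint_iff, codisjoint_iff] at hAB ⊢
    exact ⟨Subrepresentation.toSubmodule_injective (show A'.toSubmodule ⊓ B'.toSubmodule = ⊥ from
        congrArg Subrepresentation.toSubmodule hAB.1),
      Subrepresentation.toSubmodule_injective (show A'.toSubmodule ⊔ B'.toSubmodule = ⊤ from
        congrArg Subrepresentation.toSubmodule hAB.2)⟩
  refine (hσ.2 A' B' hAB').imp (fun h => ?_) fun h => ?_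
  · exact Subrepresentation.toSubmodule_injective (show A.toSubmodule = ⊥ from
      congrArg Subrepresentation.toSubmodule h)
  · exact Subrepresentation.toSubmodule_injective (show B.toSubmodule = ⊥ from
      congrArg Subrepresentation.toSubmodule h)

variable {F : Type v} [Field F] [IsAlgClosed F] {H U : Type*} [CommGroup H] [Group U]
  [Finite H] [Finite U] {α : U →* MulAut H}
  {V : Type v} [AddCommGroup V] [Module F V] [Module.Finite F V]
  {ρ : Representation F (H ⋊[α] U) V}

/-- The module `S` is the weight space of `χ`, and `N` corresponds to `P ∩ H`. Maps `a`, `b`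
exhibiting the source are cut down to the weight space, where their composite still has non-zero
trace. -/
theorem exists_isVertexSourcePair_stabilizer {p : ℕ} [Fact p.Prime] [CharP F p]
    (hρ : IsIrreducible ρ) {Q : Type*} [Group Q] (hQ : IsPGroup p Q)
    {W : Type v} [AddCommGroup W] [Module F W] [Module.Finite F W] {σ : Representation F Q W}
    (hσ : IsIndecomposable σ) (h : IsVertexSourcePair σ ρ) :
    ∃ χ : H →* Fˣ, ∀ T : Subgroup U, IsCharStabilizer α χ T →
      ∃ (N : Subgroup Q) (_ : N.Normal) (hN : N ≤ MonoidHom.ker σ) (S : FDRep F T),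
        IsIrreducible S.ρ ∧ IsVertexSourcePair (QuotientGroup.lift N σ hN) S.ρ := by
  obtain ⟨P, hP, L, ⟨hL, hLρ⟩, φ, ψ, hφψ⟩ := h
  obtain ⟨a, b, ha, hb, hab⟩ := isDirectSummand_ind_iff.1 hLρ
  have hsurj := surjective_of_relTrace_comp_eq_one hρ hP hL ha hb hab
  have hbafix : ∀ p ∈ P, linHom ρ ρ p (b ∘ₗ a) = b ∘ₗ a := fun p hp =>
    linHom_fixed_iff.2 fun v => by
      lift p to P using hp
      rw [LinearMap.comp_apply, ha, hb, LinearMap.comp_apply]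
  obtain ⟨e, he⟩ := exists_isWeightProjection hρ (inl_comp_rightHom_apply (α := α))
  obtain ⟨χ, hχP, hne⟩ :=
    he.exists_relTrace_ne_zero hρ inl_comp_rightHom_apply hP hbafix hab
  refine ⟨χ, fun T hT => ?_⟩
  have hχ : e χ ≠ 0 := fun h0 => hne (by
    have := Fintype.ofFinite ((H ⋊[α] U) ⧸ P)
    simp [h0, relTrace])
  have hPright : ∀ g ∈ P, g.right ∈ T := fun g hg => (hT.right_mem_iff g).2 (hχP g hg)
  have hPT : P.map rightHom ≤ T := by
    rintro _ ⟨g, hg, rfl⟩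
    exact hPright g hg
  set R : Subgroup T := (P.map rightHom).subgroupOf T with hR
  let π : Q →* R :=
    { toFun := fun q => ⟨⟨(φ q : H ⋊[α] U).right, hPright _ (φ q).2⟩, φ q, (φ q).2, rfl⟩
      map_one' := by
        ext
        simp
      map_mul' := fun q q' => by
        ext
        simp }
  have hπ : Function.Surjective π := by
    rintro ⟨⟨t, ht⟩, g, hg, hgt⟩
    refine ⟨φ.symm ⟨g, hg⟩, ?_⟩
    ext
    simp only [π, MonoidHom.coe_mk, OneHom.coe_mk, MulEquiv.apply_symm_apply]
    exact hgt
  -- The left component becomes multiplicative after applying `χ`, because `P` fixes `χ`. As `Q` is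
  -- a `p`-group, `ε` is trivial, so `P` acts on the weight space through its image in `T`.
  let ε : Q →* Fˣ :=
    { toFun := fun q => χ (φ q : H ⋊[α] U).left
      map_one' := by simp
      map_mul' := fun q q' => by
        have h1 := (hT _).1 (T.inv_mem (hPright _ (φ q).2)) (φ q' : H ⋊[α] U).left
        rw [inv_inv] at h1
        rw [map_mul, Subgroup.coe_mul, mul_left, map_mul, h1] }
  have hε : ∀ q, χ (φ q : H ⋊[α] U).left = 1 := fun q => by
    obtain ⟨n, hn⟩ := hQ q
    exact apply_eq_one_of_pow_eq_one ε hn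
  have hact : ∀ q (v : weightSpace (inl : H →* H ⋊[α] U) ρ χ),
      (hT.weightRep ρ (π q) v : V) = ρ (φ q) v := fun q v => by
    rw [hT.apply_eq (φ q : H ⋊[α] U) (hPright _ (φ q).2), hε, Units.val_one, one_smul]
    rfl
  -- The kernel corresponds to `p`-elements of `H`; they act trivially on `V`, hence on its image
  -- under the surjection `a`.
  have hN : π.ker ≤ MonoidHom.ker σ := by
    intro q hq
    have hq1 : (φ q : H ⋊[α] U).right = 1 :=
      congrArg (fun r : R => ((r : T) : U)) (MonoidHom.mem_ker.1 hq)
    have hq2 : inl (φ q : H ⋊[α] U).left = (φ q : H ⋊[α] U) := by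
      ext
      · rfl
      · exact hq1.symm
    obtain ⟨n, hn⟩ := hQ q
    have hn' : (φ q : H ⋊[α] U).left ^ p ^ n = 1 := by
      apply inl_injective (φ := α)
      rw [map_pow, hq2, ← Subgroup.coe_pow, ← map_pow, hn, map_one, map_one, Subgroup.coe_one]
    rw [MonoidHom.mem_ker]
    ext x
    obtain ⟨v, hv⟩ := hsurj (ψ x)
    apply ψ.injective
    rw [hφψ, ← hv, ← ha, ← hq2, apply_eq_of_pow_eq_one he hn', hv]
    rfl
  have hlift : ∀ q : Q, QuotientGroup.lift π.ker σ hN q = σ q := fun q => rfl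
  let E := QuotientGroup.quotientKerEquivOfSurjective π hπ
  let τ : Representation F R W := (QuotientGroup.lift π.ker σ hN).comp E.symm.toMonoidHom
  have hτ : ∀ q, τ (π q) = σ q := fun q => by
    have h1 : E.symm (π q) = (q : Q ⧸ π.ker) := E.symm_apply_eq.2 rfl
    change QuotientGroup.lift π.ker σ hN (E.symm (π q)) = σ q
    rw [h1, hlift]
  have hS : IsIrreducible (hT.weightRep ρ) := hT.isIrreducible_weightRep hρ he hχ
  let a' : weightSpace (inl : H →* H ⋊[α] U) ρ χ →ₗ[F] W :=
    ψ.symm.toLinearMap ∘ₗ a ∘ₗ (weightSpace (inl : H →* H ⋊[α] U) ρ χ).subtype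
  let b' : W →ₗ[F] weightSpace (inl : H →* H ⋊[α] U) ρ χ :=
    (e χ).codRestrict _ (he.apply_mem χ) ∘ₗ b ∘ₗ ψ.toLinearMap
  have ha' : ∀ (r : R) v, a' (hT.weightRep ρ r v) = τ r (a' v) := fun r v => by
    obtain ⟨q, rfl⟩ := hπ r
    apply ψ.injective
    rw [hτ, hφψ]
    simp only [a', LinearMap.comp_apply, Submodule.subtype_apply, LinearEquiv.coe_coe,
      LinearEquiv.apply_symm_apply]
    rw [hact, ha]
  have hb' : ∀ (r : R) w, b' (τ r w) = hT.weightRep ρ r (b' w) := fun r w => by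
    obtain ⟨q, rfl⟩ := hπ r
    apply Subtype.ext
    rw [hτ, hact]
    change e χ (b (ψ (σ q w))) = ρ (φ q) (e χ (b (ψ w)))
    rw [hφψ, hb, hT.apply_comm he (hPright _ (φ q).2)]
  have hba' : b' ∘ₗ a' = weightCompress he (b ∘ₗ a) := by
    ext v
    change e χ (b (ψ (ψ.symm (a v)))) = e χ (b (a v))
    rw [LinearEquiv.apply_symm_apply]
  have hfix' : ∀ r ∈ R, linHom (hT.weightRep ρ) (hT.weightRep ρ) r (b' ∘ₗ a') = b' ∘ₗ a' :=
    fun r hr => linHom_fixed_iff.2 fun v => by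
      lift r to R using hr
      rw [LinearMap.comp_apply, ha', hb']
      rfl
  have hfix : ∀ p ∈ P, linHom ρ ρ p (e χ * (b ∘ₗ a) * e χ) = e χ * (b ∘ₗ a) * e χ :=
    fun p hp => by
      rw [linHom_mul, linHom_mul, hbafix p hp, ← he.smul_eq inl_comp_rightHom_apply, hχP p hp]
  have hne' : relTrace (linHom (hT.weightRep ρ) (hT.weightRep ρ)) R (b' ∘ₗ a') ≠ 0 := by
    rw [hba'] at hfix' ⊢
    exact hT.relTrace_weightCompress_ne_zero he hρ hPT hfix hfix' hne hχ
  obtain ⟨c, hc⟩ := exists_relTrace_eq_one hS hfix' hne'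
  refine ⟨π.ker, inferInstance, hN, FDRep.of (hT.weightRep ρ), hS, R, ⟨?_, ?_⟩, FDRep.of τ,
    ⟨isIndecomposable_of_surjective hτ hσ, ?_⟩, E, LinearEquiv.refl F W, fun g x => ?_⟩
  · exact isRelativelyProjective_of_relTrace_ne_zero hS hfix' hne'
  · exact fun Q' hQ' hle => hT.isRelativelyProjective_imp_le he hρ hP hfix hne hχ hQ' hle
  · refine isDirectSummand_ind_iff.2 ⟨a', c • b', ha', fun r w => ?_, hc⟩
    rw [LinearMap.smul_apply, LinearMap.smul_apply, map_smul]
    exact congrArg (c • ·) (hb' r w)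
  · change QuotientGroup.lift π.ker σ hN g x = QuotientGroup.lift π.ker σ hN (E.symm (E g)) x
    rw [MulEquiv.symm_apply_apply]

end VertexSource

end FeitSource

namespace FeitSource

/-! ### Linear characters, inflation and the finiteness count -/

open Representation SemidirectProduct

/-- The one-dimensional representation given by a linear character. -/
noncomputable def charRep {F : Type*} [Field F] {H : Type*} [Group H] (χ : H →* Fˣ) :
    Representation F H F :=
  ((algebraMap F (Module.End F F)).toMonoidHom).comp ((Units.coeHom F).comp χ)

theorem charRep_apply {F : Type*} [Field F] {H : Type*} [Group H] (χ : H →* Fˣ) (h : H) (x : F) :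
    charRep χ h x = χ h * x := rfl

theorem isIrreducible_charRep {F : Type*} [Field F] {H : Type*} [Group H] (χ : H →* Fˣ) :
    IsIrreducible (charRep χ) := by
  have : Nontrivial (Subrepresentation (charRep χ)) :=
    ⟨⊥, ⊤, fun h => bot_ne_top (congrArg Subrepresentation.toSubmodule h)⟩
  refine { eq_bot_or_eq_top := fun X => ?_ }
  rcases eq_bot_or_eq_top (α := Submodule F F) X.toSubmodule with h | h
  · exact Or.inl (Subrepresentation.toSubmodule_injective h)
  · exact Or.inr (Subrepresentation.toSubmodule_injective h)

/-- One-dimensional modules are isomorphic exactly when their characters agree. -/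
theorem isCharStabilizer_complementInertialGroup {F : Type*} [Field F] {H U : Type*} [CommGroup H]
    [Group U] (α : U →* MulAut H) (χ : H →* Fˣ) :
    IsCharStabilizer α χ (complementInertialGroup α (charRep χ)) := by
  have hconj : ∀ (u : U) (h : H),
      (MulAut.conjNormal (inr u : H ⋊[α] U)⁻¹ (MonoidHom.ofInjective inl_injective h) :
        (inl : H →* H ⋊[α] U).range) = MonoidHom.ofInjective inl_injective (α u⁻¹ h) := by
    intro u h
    apply Subtype.ext
    rw [MulAut.conjNormal_apply, MonoidHom.ofInjective_apply, MonoidHom.ofInjective_apply, inl_aut,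
      inv_inv, ← map_inv, inv_inv]
  intro u
  have hmem : u ∈ complementInertialGroup α (charRep χ) ↔ ∃ ψ : F ≃ₗ[F] F, ∀ (h : H) (x : F),
      ψ (χ (α u⁻¹ h) * x) = χ h * ψ x := by
    refine exists_congr fun ψ => ?_
    rw [(MonoidHom.ofInjective (inl_injective (φ := α))).surjective.forall]
    refine forall_congr' fun h => forall_congr' fun x => ?_
    rw [hconj]
    simp [charRep_apply]
  rw [hmem]
  constructor
  · rintro ⟨ψ, hψ⟩ h
    have h1 := hψ h 1
    rw [← smul_eq_mul, map_smul, smul_eq_mul] at h1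
    have h2 : ψ 1 ≠ 0 := fun h0 => one_ne_zero (ψ.map_eq_zero_iff.1 h0)
    exact Units.ext (mul_right_cancel₀ h2 h1)
  · intro h
    exact ⟨LinearEquiv.refl F F, fun x y => by rw [h]; rfl⟩

/-- The inflation of a module along the twist by an automorphism of the quotient map. -/
noncomputable def inflateTwist {F : Type v} [Field F] {Q : Type u} [Group Q] (N : Subgroup Q)
    [N.Normal] (θ : Q ⧸ N ≃* Q ⧸ N) (L : FDRep F (Q ⧸ N)) : FDRep F Q :=
  FDRep.of (L.ρ.comp (θ.toMonoidHom.comp (QuotientGroup.mk' N)))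

/-- A chosen representative of a class over `Q ⧸ N` agrees with the given module only up to an
automorphism of `Q ⧸ N`, which need not lift to `Q`; the twist `θ` undoes it before inflation. -/
theorem exists_mk_inflateTwist_eq {F : Type v} [Field F] {Q : Type u} [Group Q] {N : Subgroup Q}
    [N.Normal] (L : FDRep F Q) (hN : N ≤ MonoidHom.ker L.ρ) :
    ∃ θ : Q ⧸ N ≃* Q ⧸ N, Quotient.mk (pairSetoid F Q) (inflateTwist N θ
      (Quotient.mk (pairSetoid F (Q ⧸ N)) (FDRep.of (QuotientGroup.lift N L.ρ hN))).out) =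
        Quotient.mk (pairSetoid F Q) L := by
  obtain ⟨θ, ψ, h⟩ : PairEquiv
      (Quotient.mk (pairSetoid F (Q ⧸ N)) (FDRep.of (QuotientGroup.lift N L.ρ hN))).out.ρ
      (QuotientGroup.lift N L.ρ hN) :=
    Quotient.mk_out (s := pairSetoid F (Q ⧸ N)) (FDRep.of (QuotientGroup.lift N L.ρ hN))
  refine ⟨θ.symm, Quotient.sound ⟨MulEquiv.refl Q, ψ, fun q x => ?_⟩⟩
  have h1 := h (θ.symm q) x
  rw [MulEquiv.apply_symm_apply] at h1
  exact h1

end FeitSource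

open FeitSource in
theorem theorem6p2 (p : ℕ) [Fact p.Prime] (F : Type v) [Field F] [IsAlgClosed F] [CharP F p]
    (H : Type u) [CommGroup H] [Finite H] (𝒰 : Set FiniteGrp.{u})
    (hT : FeitSource.FeitConjectureHolds p F (FeitSource.inertialSubgroups F H 𝒰)) :
    FeitSource.FeitConjectureHolds p F (FeitSource.semidirectProducts H 𝒰) := by
  intro Q hQ
  -- All classes over `Q` will be found among the twisted inflations from the quotients of `Q`, a
  -- finite union of images of sets that are finite by hypothesis.
  have hfin : (⋃ (N : Subgroup Q) (_ : N.Normal) (θ : Q ⧸ N ≃* Q ⧸ N),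
      (fun c : Quotient (pairSetoid F (Q ⧸ N)) =>
        Quotient.mk (pairSetoid F Q) (inflateTwist N θ c.out)) ''
          vertexSourceClasses F (inertialSubgroups F H 𝒰) (Q ⧸ N)).Finite := by
    refine Set.finite_iUnion fun N => Set.finite_iUnion fun _ => ?_
    have : Finite (Q ⧸ N ≃* Q ⧸ N) := DFunLike.finite _
    exact Set.finite_iUnion fun θ =>
      (hT (FiniteGrp.of (Q ⧸ N)) (hQ.to_quotient N)).image _
  refine hfin.subset ?_
  rintro _ ⟨L, rfl, hL, _, ⟨U, hU, α, rfl⟩, M, hM, hLM⟩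
  obtain ⟨χ, hχ⟩ := exists_isVertexSourcePair_stabilizer (α := α) (ρ := M.ρ) hM hQ hL hLM
  obtain ⟨N, hN, hNL, S, hS, hLS⟩ := hχ _ (isCharStabilizer_complementInertialGroup α χ)
  obtain ⟨θ, hθ⟩ := exists_mk_inflateTwist_eq L hNL
  simp only [Set.mem_iUnion]
  refine ⟨N, hN, θ, _, ⟨FDRep.of (QuotientGroup.lift N L.ρ hNL), rfl,
    isIndecomposable_of_surjective (π := QuotientGroup.mk) (fun _ => rfl) hL, _,
    ⟨U, hU, α, FDRep.of (charRep χ), isIrreducible_charRep χ, rfl⟩, S, hS, hLS⟩, hθ⟩
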